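/- Let $N\in\mathbb N$ and $s\in(\tfrac12,1)$ with $N>2s$, let $\lambda>0$, $R_0>0$, and let $f\colon(0,\infty)\to(0,\infty)$ be continuous and nondecreasing with $$\liminf_{t\to0^+}\frac{f(t)}{t^{p}}>0,\qquad p=\frac{N}{N-2s}.$$ If $q>\frac{N}{N+1-2s}$, then there is no positive classical supersolution of $$(-\Delta)^s u+|\nabla u|^q=\lambda f(u)\quad\text{in } \{x\in\mathbb R^N: |x|>R_0\}$$ that does not blow up at infinity. Explicitly, there is no function $u\colon\mathbb R^N\to(0,\infty)$ such that * $u$ is of class $C^2$ in $\{|x|>R_0\}$ and $\int_{\mathbb R^N}\frac{|u(x)|}{1+|x|^{N+2s}}\,dx<\infty$; * $(-\Delta)^su(x)+|\nabla u(x)|^q\ge\lambda f(u(x))$ for all $|x|>R_0$; * $u(x)\not\to+\infty$ as $|x|\to\infty$, i.e. $\liminf_{|x|\to\infty}u(x)<+\infty$. Here $(-\Delta)^su(x)=C_{N,s}\lim_{\varepsilon\to0^+}\int_{|x-y|\ge\varepsilon}\frac{u(x)-u(y)}{|x-y|^{N+2s}}\,dy$ with the usual normalization constant $C_{N,s}=\frac{s\,4^s\,\Gamma(N/2+s)}{\pi^{N/2}\,\Gamma(1-s)}$.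 -/

import Mathlib

open Filter Topology MeasureTheory

noncomputable section

/-- The normalization constant `C_{N,s} = s 4^s Γ(N/2 + s) / (π^{N/2} Γ(1 - s))` of the
fractional Laplacian on `ℝ^N`. It is positive for `0 < s < 1`. -/
def fracLaplacianConst (N : ℕ) (s : ℝ) : ℝ :=
  s * (4 : ℝ) ^ s * Real.Gamma ((N : ℝ) / 2 + s) /
    (Real.pi ^ ((N : ℝ) / 2) * Real.Gamma (1 - s))

/-- `(-Δ)^s u (x) = L`, the singular integral being taken in the principal value sense:
`C_{N,s} ∫_{ℝ^N ∖ B_ε(x)} (u(x) - u(y)) / |x - y|^{N+2s} dy → L` as `ε → 0+`. -/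
def HasFracLaplacianAt {N : ℕ} (s : ℝ) (u : EuclideanSpace ℝ (Fin N) → ℝ)
    (x : EuclideanSpace ℝ (Fin N)) (L : ℝ) : Prop :=
  Tendsto
    (fun ε : ℝ => fracLaplacianConst N s *
      ∫ y in (Metric.ball x ε)ᶜ, (u x - u y) / ‖x - y‖ ^ ((N : ℝ) + 2 * s))
    (𝓝[>] 0) (𝓝 L)

/-- The weighted space `𝓛_{2s}`: measurable `u` with `∫ |u(x)| / (1 + |x|^{N+2s}) dx < ∞`. -/
def MemWeightedL1 {N : ℕ} (s : ℝ) (u : EuclideanSpace ℝ (Fin N) → ℝ) : Prop :=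
  Integrable (fun x => u x / (1 + ‖x‖ ^ ((N : ℝ) + 2 * s))) volume

/-- `u` is a classical supersolution of `(-Δ)^s u + |∇u|^q = lam * f(u)` in `|x| > R₀`. -/
structure IsClassicalSupersolution {N : ℕ} (s q lam R₀ : ℝ) (f : ℝ → ℝ)
    (u : EuclideanSpace ℝ (Fin N) → ℝ) : Prop where
  contDiffOn : ContDiffOn ℝ 2 u {x | R₀ < ‖x‖}
  memWeightedL1 : MemWeightedL1 s u
  inequality : ∀ x, R₀ < ‖x‖ →
    ∃ L, HasFracLaplacianAt s u x L ∧ lam * f (u x) ≤ L + ‖gradient u x‖ ^ q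

/-- `u` blows up at infinity: `u(x) → +∞` as `|x| → ∞`. -/
def BlowsUpAtInfinity {N : ℕ} (u : EuclideanSpace ℝ (Fin N) → ℝ) : Prop :=
  Tendsto u (Bornology.cobounded (EuclideanSpace ℝ (Fin N))) atTop

end

/-!
Write `b = N - 2s`, so that `p = N / b` and the hypothesis on `q` reads `q (b + 1) > N`. If a
function `φ` touches the supersolution `u` from below at `x`, then `λ f(u(x)) ≤ (-Δ)^s φ(x) +
|∇φ(x)|^q` (`IsClassicalSupersolution.le_of_touching`). All information on `u` is drawn from this,
with two kinds of test functions.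

Barriers give lower bounds. The superposition `Γ(x) = ∫₁^∞ t^{-b} η(x/t) dt/t` of dilates of a
radial bump `η` is comparable to `|x|^{-b}`, and `(-Δ)^s Γ = O(|x|^{-N-2s})` because `(-Δ)^s η`
has integral zero (`exists_symFracLap_scaleAvg_bump_decay`). By convexity of `X ↦ X^{1+κ}`, the
function `Γ + Γ^{1+κ}` has `(-Δ)^s ≤ -c |x|^{-N-κb}` far out; for small `κ` this absorbs the
gradient term, whose decay exponent can be taken larger than `N`. Comparison gives `u ≥ c
|x|^{-b}`, hence `f(u) ≥ c |x|^{-N}`. Applying the superposition to `Γ` again gives a function of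
order `|x|^{-b} log |x|` with `(-Δ)^s ≤ C |x|^{-N}`, and comparison improves the bound to `u ≥ c
|x|^{-b} log |x|` (`IsClassicalSupersolution.exists_log_le`).

Bumps at scale `|z|` around a point `z` give upper bounds: at some `x` with `|x - z| < |z| / 2`
and `u(x) ≤ u(z)`, `f(u(x)) ≤ C (u(z) |z|^{-2s} + (u(z) / |z|)^q)`. If `u` does not blow up, this
forces its lower limit at infinity to be zero. The polynomial lower bound then yields points `z`
arbitrarily far out at which `u` is small and comparable to its minimum over the ball of radius
`|z| / 2` (`exists_harnack_point`). For such `z` one obtains `u(z)^p ≤ C (u(z) |z|^{-2s} + (u(z) /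
|z|)^q)`, which is incompatible with `u(z) ≥ c |z|^{-b} log |z|` for large `|z|`
(`exists_forall_add_rpow_lt`).
-/

noncomputable section

open Set Metric

variable {N : ℕ} {s : ℝ}

/-! ### Second differences and truncated singular integrals -/

/-- The symmetric second difference `2 φ(x) - φ(x + y) - φ(x - y)`. -/
def secondDiff (φ : EuclideanSpace ℝ (Fin N) → ℝ) (x y : EuclideanSpace ℝ (Fin N)) : ℝ :=
  2 * φ x - φ (x + y) - φ (x - y)

/-- The fractional Laplacian of `φ` at `x`, up to the factor `C_{N,s}`, written with symmetric
second differences. For `φ` of class `C^{1,1}` the integral converges absolutely, so no principal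
value is needed. -/
def symFracLap (s : ℝ) (φ : EuclideanSpace ℝ (Fin N) → ℝ) (x : EuclideanSpace ℝ (Fin N)) : ℝ :=
  1 / 2 * ∫ y, secondDiff φ x y / ‖y‖ ^ ((N : ℝ) + 2 * s)

/-- The truncated singular integral whose limit as `ε → 0+` is the fractional Laplacian, without
the factor `C_{N,s}`. -/
def truncFracLap (s : ℝ) (φ : EuclideanSpace ℝ (Fin N) → ℝ) (x : EuclideanSpace ℝ (Fin N))
    (ε : ℝ) : ℝ :=
  ∫ y in (ball x ε)ᶜ, (φ x - φ y) / ‖x - y‖ ^ ((N : ℝ) + 2 * s)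

/-- A quantitative form of being bounded and of class `C^{1,1}`: `φ` is continuous, `|φ| ≤ B`, and
its second differences are at most `B min(1, |y|²)`. Unlike `C²`, this passes to superpositions of
dilates by integrating the inequality. -/
structure HasSecondDiffBound (φ : EuclideanSpace ℝ (Fin N) → ℝ) (B : ℝ) : Prop where
  continuous : Continuous φ
  abs_le : ∀ x, |φ x| ≤ B
  secondDiff_le : ∀ x y, |secondDiff φ x y| ≤ B * min 1 (‖y‖ ^ 2)

/-- The upper limit of the truncated integrals of `φ` at `x` is at most `l`, that is `(-Δ)^s φ (x)
≤ C_{N,s} l` in a one-sided sense. Only this side matters for a function touching a supersolution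
from below, and it makes sense where the principal value might not exist. -/
def HasFracUpper (s : ℝ) (φ : EuclideanSpace ℝ (Fin N) → ℝ) (x : EuclideanSpace ℝ (Fin N))
    (l : ℝ) : Prop :=
  ∀ δ > 0, ∀ᶠ ε in 𝓝[>] (0 : ℝ), truncFracLap s φ x ε ≤ l + δ

lemma euclidean_nontrivial (hN : 0 < N) : Nontrivial (EuclideanSpace ℝ (Fin N)) :=
  Module.nontrivial_of_finrank_pos (R := ℝ) (by simpa using hN)

lemma integrable_kernel (hN : 0 < N) (hs : 0 < s) (hs1 : s < 1) :
    Integrable (fun y : EuclideanSpace ℝ (Fin N) =>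
      min 1 (‖y‖ ^ 2) / ‖y‖ ^ ((N : ℝ) + 2 * s)) := by
  have := euclidean_nontrivial hN
  have hN' : ((N - 1 : ℕ) : ℝ) = N - 1 := by rw [Nat.cast_sub hN]; simp
  rw [integrable_fun_norm_addHaar volume
    (f := fun r : ℝ => min 1 (r ^ 2) / r ^ ((N : ℝ) + 2 * s))]
  rw [← Ioc_union_Ioi_eq_Ioi zero_le_one]
  refine IntegrableOn.union ?_ ?_
  · have h := intervalIntegral.intervalIntegrable_rpow' (a := 0) (b := 1) (r := 1 - 2 * s)
      (by linarith)
    rw [intervalIntegrable_iff_integrableOn_Ioc_of_le zero_le_one] at h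
    refine h.congr_fun (fun r hr => ?_) measurableSet_Ioc
    have h0 := hr.1
    have h1 : min 1 (r ^ 2) = r ^ 2 := min_eq_right (by nlinarith [hr.2])
    simp only [finrank_euclideanSpace, Fintype.card_fin, smul_eq_mul, h1]
    rw [← Real.rpow_natCast, ← Real.rpow_natCast, ← Real.rpow_sub h0, ← Real.rpow_add h0, hN']
    congr 1; push_cast; ring
  · refine (integrableOn_Ioi_rpow_of_lt (a := -1 - 2 * s) (by linarith) zero_lt_one).congr_fun
      (fun r hr => ?_) measurableSet_Ioi
    have h1 : (1:ℝ) < r := hr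
    have h0 : 0 < r := by linarith
    have h1 : min 1 (r ^ 2) = r ^ 0 := by rw [min_eq_left (by nlinarith)]; simp
    simp only [finrank_euclideanSpace, Fintype.card_fin, smul_eq_mul, h1]
    rw [← Real.rpow_natCast, ← Real.rpow_natCast, ← Real.rpow_sub h0, ← Real.rpow_add h0, hN']
    congr 1; push_cast; ring

lemma min_one_sq_mono {ε r : ℝ} (hε : 0 < ε) (hr : ε ≤ r) : min 1 (ε ^ 2) ≤ min 1 (r ^ 2) :=
  min_le_min le_rfl (by gcongr)

lemma integrableOn_kernel_compl_ball (hN : 0 < N) (hs : 0 < s) (hs1 : s < 1) {ε : ℝ} (hε : 0 < ε)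
    (x : EuclideanSpace ℝ (Fin N)) :
    IntegrableOn (fun y => 1 / ‖x - y‖ ^ ((N : ℝ) + 2 * s)) (ball x ε)ᶜ := by
  have h := ((integrable_kernel hN hs hs1).comp_sub_left x).const_mul (min 1 (ε ^ 2))⁻¹
  have hm : 0 < min 1 (ε ^ 2) := by positivity
  refine h.integrableOn.mono' (Measurable.aestronglyMeasurable (by fun_prop)) ?_
  refine (ae_restrict_iff' measurableSet_ball.compl).2 (Eventually.of_forall fun y hy => ?_)
  have hy' : ε ≤ ‖x - y‖ := by
    simpa [mem_ball, dist_eq_norm, norm_sub_rev] using hy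
  have := min_one_sq_mono hε hy'
  rw [Real.norm_of_nonneg (by positivity), ← mul_div_assoc]
  gcongr
  rw [inv_mul_eq_div, one_le_div hm]
  exact this

lemma integrableOn_trunc (hN : 0 < N) (hs : 0 < s) (hs1 : s < 1) {ε : ℝ} (hε : 0 < ε)
    {φ : EuclideanSpace ℝ (Fin N) → ℝ} {B : ℝ} (hφ : AEStronglyMeasurable φ)
    (hB : ∀ x, |φ x| ≤ B) (x : EuclideanSpace ℝ (Fin N)) :
    IntegrableOn (fun y => (φ x - φ y) / ‖x - y‖ ^ ((N : ℝ) + 2 * s)) (ball x ε)ᶜ := by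
  have h := (integrableOn_kernel_compl_ball hN hs hs1 hε x).const_mul (B + B)
  refine h.mono' ?_ (Eventually.of_forall fun y => ?_)
  · exact ((aestronglyMeasurable_const.sub hφ.restrict).aemeasurable.div
      (by fun_prop)).aestronglyMeasurable
  · rw [norm_div, Real.norm_of_nonneg (by positivity : 0 ≤ ‖x - y‖ ^ ((N : ℝ) + 2 * s)),
      mul_one_div]
    gcongr
    exact (abs_sub _ _).trans (add_le_add (hB x) (hB y))

/-- Averaging the substitutions `y ↦ x + y` and `y ↦ x - y` symmetrizes the truncated integral. -/
lemma truncFracLap_eq (hN : 0 < N) (hs : 0 < s) (hs1 : s < 1) {ε : ℝ} (hε : 0 < ε)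
    {φ : EuclideanSpace ℝ (Fin N) → ℝ} {B : ℝ} (hφ : AEStronglyMeasurable φ)
    (hB : ∀ x, |φ x| ≤ B) (x : EuclideanSpace ℝ (Fin N)) :
    truncFracLap s φ x ε =
      1 / 2 * ∫ y, (ball 0 ε)ᶜ.indicator
        (fun y => secondDiff φ x y / ‖y‖ ^ ((N : ℝ) + 2 * s)) y := by
  have hint := integrableOn_trunc hN hs hs1 hε hφ hB x
  rw [← integrable_indicator_iff measurableSet_ball.compl] at hint
  set F := (ball x ε)ᶜ.indicator fun y => (φ x - φ y) / ‖x - y‖ ^ ((N : ℝ) + 2 * s) with hF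
  have hT : truncFracLap s φ x ε = ∫ y, F y := by
    rw [truncFracLap, integral_indicator measurableSet_ball.compl]
  have h1 : ∫ y, F (x + y) = ∫ y, F y := integral_add_left_eq_self F x
  have h2 : ∫ y, F (x - y) = ∫ y, F y := integral_sub_left_eq_self F volume x
  have h3 : ∀ y, F (x + y) + F (x - y) = (ball 0 ε)ᶜ.indicator
        (fun y => secondDiff φ x y / ‖y‖ ^ ((N : ℝ) + 2 * s)) y := by
    intro y
    by_cases hy : ‖y‖ < ε
    · simp [hF, indicator, hy]
    · simp only [hF, indicator, mem_compl_iff, mem_ball, dist_eq_norm, add_sub_cancel_left, hy,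
        not_false_iff, if_true, sub_zero, sub_sub_cancel_left, norm_neg, sub_add_cancel_left,
        sub_sub_cancel, secondDiff]
      ring
  rw [hT, ← integral_congr_ae (Eventually.of_forall h3),
    integral_add (hint.comp_add_left x) (hint.comp_sub_left x), h1, h2]
  ring

lemma HasSecondDiffBound.nonneg {φ : EuclideanSpace ℝ (Fin N) → ℝ} {B : ℝ}
    (h : HasSecondDiffBound φ B) : 0 ≤ B := (abs_nonneg _).trans (h.abs_le 0)

lemma HasSecondDiffBound.norm_integrand_le {φ : EuclideanSpace ℝ (Fin N) → ℝ} {B : ℝ}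
    (h : HasSecondDiffBound φ B) (x y : EuclideanSpace ℝ (Fin N)) :
    ‖secondDiff φ x y / ‖y‖ ^ ((N : ℝ) + 2 * s)‖ ≤
      B * (min 1 (‖y‖ ^ 2) / ‖y‖ ^ ((N : ℝ) + 2 * s)) := by
  rw [norm_div, Real.norm_of_nonneg (by positivity : 0 ≤ ‖y‖ ^ ((N : ℝ) + 2 * s)),
    ← mul_div_assoc]
  gcongr
  exact h.secondDiff_le x y

lemma Continuous.secondDiff {φ : EuclideanSpace ℝ (Fin N) → ℝ} (h : Continuous φ) :
    Continuous fun p : EuclideanSpace ℝ (Fin N) × EuclideanSpace ℝ (Fin N) =>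
      secondDiff φ p.1 p.2 := by
  unfold _root_.secondDiff; fun_prop

lemma HasSecondDiffBound.measurable_integrand {φ : EuclideanSpace ℝ (Fin N) → ℝ} {B : ℝ}
    (h : HasSecondDiffBound φ B) (x : EuclideanSpace ℝ (Fin N)) :
    Measurable fun y => secondDiff φ x y / ‖y‖ ^ ((N : ℝ) + 2 * s) := by
  have := (h.continuous.secondDiff.comp (Continuous.prodMk_right x)).measurable
  simp only [Function.comp_def] at this
  fun_prop

lemma HasSecondDiffBound.tendsto_truncFracLap {φ : EuclideanSpace ℝ (Fin N) → ℝ} {B : ℝ}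
    (h : HasSecondDiffBound φ B) (hN : 0 < N) (hs : 0 < s) (hs1 : s < 1)
    (x : EuclideanSpace ℝ (Fin N)) :
    Tendsto (truncFracLap s φ x) (𝓝[>] 0) (𝓝 (symFracLap s φ x)) := by
  have key : Tendsto (fun ε : ℝ => ∫ y, (ball 0 ε)ᶜ.indicator
        (fun y => secondDiff φ x y / ‖y‖ ^ ((N : ℝ) + 2 * s)) y) (𝓝[>] 0)
        (𝓝 (∫ y, secondDiff φ x y / ‖y‖ ^ ((N : ℝ) + 2 * s))) := by
    refine tendsto_integral_filter_of_dominated_convergence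
      (fun y => B * (min 1 (‖y‖ ^ 2) / ‖y‖ ^ ((N : ℝ) + 2 * s))) ?_ ?_
      ((integrable_kernel hN hs hs1).const_mul B) ?_
    · exact Eventually.of_forall fun ε =>
        ((h.measurable_integrand x).indicator measurableSet_ball.compl).aestronglyMeasurable
    · exact Eventually.of_forall fun ε => Eventually.of_forall fun y =>
        (norm_indicator_le_norm_self _ _).trans (h.norm_integrand_le x y)
    · refine Eventually.of_forall fun y => ?_
      rcases eq_or_ne y 0 with rfl | hy
      · have : ∀ ε : ℝ, (ball (0 : EuclideanSpace ℝ (Fin N)) ε)ᶜ.indicator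
          (fun y => secondDiff φ x y / ‖y‖ ^ ((N : ℝ) + 2 * s)) 0 =
            secondDiff φ x 0 / ‖(0 : EuclideanSpace ℝ (Fin N))‖ ^ ((N : ℝ) + 2 * s) := by
          intro ε
          have : secondDiff φ x 0 = 0 := by simp [secondDiff]; ring
          simp [indicator, this]
        simp only [this]
        exact tendsto_const_nhds
      · refine tendsto_const_nhds.congr' ?_
        have : ∀ᶠ ε : ℝ in 𝓝[>] 0, ε < ‖y‖ :=
          nhdsWithin_le_nhds (eventually_lt_nhds (norm_pos_iff.2 hy))
        filter_upwards [this] with ε hε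
        rw [indicator_of_mem]
        simpa using hε.le
  refine (key.const_mul (1 / 2)).congr' ?_
  filter_upwards [self_mem_nhdsWithin] with ε hε
  rw [truncFracLap_eq hN hs hs1 hε h.continuous.aestronglyMeasurable h.abs_le x]

lemma HasSecondDiffBound.hasFracUpper {φ : EuclideanSpace ℝ (Fin N) → ℝ} {B : ℝ}
    (h : HasSecondDiffBound φ B) (hN : 0 < N) (hs : 0 < s) (hs1 : s < 1)
    (x : EuclideanSpace ℝ (Fin N)) : HasFracUpper s φ x (symFracLap s φ x) := by
  intro δ hδ
  exact (h.tendsto_truncFracLap hN hs hs1 x).eventually (eventually_le_nhds (by linarith))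

lemma HasSecondDiffBound.abs_symFracLap_le {φ : EuclideanSpace ℝ (Fin N) → ℝ} {B : ℝ}
    (h : HasSecondDiffBound φ B) (hN : 0 < N) (hs : 0 < s) (hs1 : s < 1)
    (x : EuclideanSpace ℝ (Fin N)) :
    |symFracLap s φ x| ≤ B * ∫ y : EuclideanSpace ℝ (Fin N),
      min 1 (‖y‖ ^ 2) / ‖y‖ ^ ((N : ℝ) + 2 * s) := by
  have h1 := norm_integral_le_of_norm_le ((integrable_kernel (N := N) hN hs hs1).const_mul B)
    (Eventually.of_forall fun y => h.norm_integrand_le (s := s) x y)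
  rw [integral_const_mul] at h1
  rw [symFracLap, abs_mul, abs_of_nonneg (by norm_num : (0 : ℝ) ≤ 1 / 2)]
  have h2 := norm_nonneg (∫ y, secondDiff φ x y / ‖y‖ ^ ((N : ℝ) + 2 * s))
  rw [Real.norm_eq_abs] at h1 h2
  linarith

/-- The fractional Laplacian is homogeneous of degree `2s` under dilations. -/
lemma symFracLap_comp_smul (φ : EuclideanSpace ℝ (Fin N) → ℝ) {t : ℝ} (ht : 0 < t)
    (x : EuclideanSpace ℝ (Fin N)) :
    symFracLap s (fun y => φ (t⁻¹ • y)) x = t ^ (-(2 * s)) * symFracLap s φ (t⁻¹ • x) := by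
  have h := Measure.integral_comp_inv_smul_of_nonneg volume
    (fun y : EuclideanSpace ℝ (Fin N) =>
      secondDiff φ (t⁻¹ • x) y / ‖y‖ ^ ((N : ℝ) + 2 * s)) ht.le
  have h2 : ∀ y : EuclideanSpace ℝ (Fin N),
      secondDiff (fun y => φ (t⁻¹ • y)) x y / ‖y‖ ^ ((N : ℝ) + 2 * s) =
      t ^ (-((N : ℝ) + 2 * s)) * (secondDiff φ (t⁻¹ • x) (t⁻¹ • y) /
        ‖t⁻¹ • y‖ ^ ((N : ℝ) + 2 * s)) := by
    intro y
    rw [norm_smul, Real.norm_of_nonneg (by positivity), Real.mul_rpow (by positivity)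
      (by positivity), Real.inv_rpow ht.le, Real.rpow_neg ht.le]
    simp only [secondDiff, smul_add, smul_sub]
    have : 0 < t ^ ((N : ℝ) + 2 * s) := by positivity
    field_simp
  unfold symFracLap
  simp_rw [h2]
  rw [integral_const_mul, h, finrank_euclideanSpace, Fintype.card_fin, smul_eq_mul,
    ← Real.rpow_natCast]
  have : t ^ (-(2 * s)) = t ^ (-((N : ℝ) + 2 * s)) * t ^ (N : ℝ) := by
    rw [← Real.rpow_add ht]; congr 1; ring
  rw [this]; ring

/-! ### The bump function -/

/-- The radial bump `(1 - |x|²)₊²`, supported in the unit ball. It is only of class `C^{1,1}`,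
which is all that is used, and its second differences can be bounded by hand. The clipped form
`min ‖x‖ 1` makes its Lipschitz bound immediate. -/
def bump (x : EuclideanSpace ℝ (Fin N)) : ℝ := (1 - min ‖x‖ 1 ^ 2) ^ 2

lemma bump_eq (x : EuclideanSpace ℝ (Fin N)) : bump x = max 0 (1 - ‖x‖ ^ 2) ^ 2 := by
  have := norm_nonneg x
  rcases le_total ‖x‖ 1 with h | h
  · rw [bump, min_eq_left h, max_eq_right (by nlinarith)]
  · rw [bump, min_eq_right h, max_eq_left (by nlinarith)]; norm_num

lemma bump_nonneg (x : EuclideanSpace ℝ (Fin N)) : 0 ≤ bump x := sq_nonneg _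

lemma bump_le_one (x : EuclideanSpace ℝ (Fin N)) : bump x ≤ 1 := by
  have h0 : 0 ≤ min ‖x‖ 1 := by positivity
  have h1 : min ‖x‖ 1 ≤ 1 := min_le_right _ _
  unfold bump
  apply pow_le_one₀ <;> nlinarith

lemma bump_zero : bump (0 : EuclideanSpace ℝ (Fin N)) = 1 := by simp [bump]

lemma bump_eq_zero {x : EuclideanSpace ℝ (Fin N)} (h : 1 ≤ ‖x‖) : bump x = 0 := by
  simp [bump, min_eq_right h]

lemma bump_ge {x : EuclideanSpace ℝ (Fin N)} (h : ‖x‖ ≤ 1 / 2) : 1 / 2 ≤ bump x := by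
  have := norm_nonneg x
  rw [bump, min_eq_left (by linarith)]
  nlinarith [sq_nonneg (‖x‖ ^ 2)]

lemma continuous_bump : Continuous (bump : EuclideanSpace ℝ (Fin N) → ℝ) := by
  unfold bump; fun_prop

lemma abs_bump_sub_le (x y : EuclideanSpace ℝ (Fin N)) : |bump x - bump y| ≤ 4 * ‖x - y‖ := by
  have h : |min ‖x‖ 1 - min ‖y‖ 1| ≤ ‖x - y‖ :=
    (abs_min_sub_min_le_max _ _ _ _).trans (by simpa using abs_norm_sub_norm_le x y)
  have a0 : 0 ≤ min ‖x‖ 1 := by positivity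
  have a1 : min ‖x‖ 1 ≤ 1 := min_le_right _ _
  have b0 : 0 ≤ min ‖y‖ 1 := by positivity
  have b1 : min ‖y‖ 1 ≤ 1 := min_le_right _ _
  unfold bump
  generalize min ‖x‖ 1 = a at *
  generalize min ‖y‖ 1 = c at *
  have e : (1 - a ^ 2) ^ 2 - (1 - c ^ 2) ^ 2 = -((a + c) * (2 - a ^ 2 - c ^ 2)) * (a - c) := by ring
  rw [e, abs_mul, abs_neg]
  have : |(a + c) * (2 - a ^ 2 - c ^ 2)| ≤ 4 := by
    rw [abs_of_nonneg (mul_nonneg (by linarith) (by nlinarith))]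
    nlinarith [mul_nonneg (add_nonneg a0 b0) (add_nonneg (sq_nonneg a) (sq_nonneg c))]
  gcongr

/-- First-order Taylor estimate for the `C^{1,1}` function `t ↦ t₊²`. -/
lemma abs_sq_max_zero_sub_le (a b : ℝ) :
    |max 0 b ^ 2 - max 0 a ^ 2 - 2 * max 0 a * (b - a)| ≤ (b - a) ^ 2 := by
  rw [abs_le]
  rcases le_total 0 a with ha | ha <;> rcases le_total 0 b with hb | hb <;>
    simp only [max_eq_left, max_eq_right, ha, hb] <;> constructor <;> nlinarith

lemma hasSecondDiffBound_bump :
    HasSecondDiffBound (bump : EuclideanSpace ℝ (Fin N) → ℝ) 54 := by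
  refine ⟨continuous_bump, fun x => ?_, fun x y => ?_⟩
  · rw [abs_of_nonneg (bump_nonneg x)]; linarith [bump_le_one x]
  have i0 := bump_nonneg x; have i1 := bump_le_one x
  have j0 := bump_nonneg (x + y); have j1 := bump_le_one (x + y)
  have k0 := bump_nonneg (x - y); have k1 := bump_le_one (x - y)
  rcases le_or_gt 1 ‖y‖ with hy | hy
  · rw [min_eq_left (by nlinarith), secondDiff, abs_le]
    constructor <;> linarith
  rw [min_eq_right (by nlinarith [norm_nonneg y])]
  -- for `|y| < 1 < 2 ≤ |x|` all three values vanish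
  rcases le_or_gt 2 ‖x‖ with hx | hx
  · have h1 : 1 ≤ ‖x + y‖ := by
      have := norm_sub_norm_le x (-y); rw [sub_neg_eq_add, norm_neg] at this; linarith
    have h2 : 1 ≤ ‖x - y‖ := by have := norm_sub_norm_le x y; linarith
    rw [secondDiff, bump_eq_zero h1, bump_eq_zero h2, bump_eq_zero (by linarith)]
    simp
  · have hi := abs_real_inner_le_norm x y
    have hxy : ‖x‖ * ‖y‖ ≤ 2 * ‖y‖ := by gcongr
    have e1 := norm_add_sq_real x y
    have e2 := norm_sub_sq_real x y
    rw [secondDiff, bump_eq, bump_eq, bump_eq, e1, e2]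
    generalize inner ℝ x y = i at *
    have p1 := abs_sq_max_zero_sub_le (1 - ‖x‖ ^ 2) (1 - (‖x‖ ^ 2 + 2 * i + ‖y‖ ^ 2))
    have p2 := abs_sq_max_zero_sub_le (1 - ‖x‖ ^ 2) (1 - (‖x‖ ^ 2 - 2 * i + ‖y‖ ^ 2))
    have m1 : max 0 (1 - ‖x‖ ^ 2) ≤ 1 := max_le zero_le_one (by nlinarith [norm_nonneg x])
    have m0 : 0 ≤ max 0 (1 - ‖x‖ ^ 2) := le_max_left _ _
    have hi2 : |i| ≤ 2 * ‖y‖ := hi.trans hxy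
    have y0 := norm_nonneg y
    have y2 : ‖y‖ ^ 2 ≤ ‖y‖ := by nlinarith
    have q1 : (1 - (‖x‖ ^ 2 + 2 * i + ‖y‖ ^ 2) - (1 - ‖x‖ ^ 2)) ^ 2 ≤ 25 * ‖y‖ ^ 2 := by
      rw [show 25 * ‖y‖ ^ 2 = (5 * ‖y‖) ^ 2 by ring]
      apply sq_le_sq' <;> linarith [(abs_le.1 hi2).1, (abs_le.1 hi2).2, sq_nonneg ‖y‖]
    have q2 : (1 - (‖x‖ ^ 2 - 2 * i + ‖y‖ ^ 2) - (1 - ‖x‖ ^ 2)) ^ 2 ≤ 25 * ‖y‖ ^ 2 := by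
      rw [show 25 * ‖y‖ ^ 2 = (5 * ‖y‖) ^ 2 by ring]
      apply sq_le_sq' <;> linarith [(abs_le.1 hi2).1, (abs_le.1 hi2).2, sq_nonneg ‖y‖]
    have r1 := abs_le.1 (p1.trans q1)
    have r2 := abs_le.1 (p2.trans q2)
    have m2 : max 0 (1 - ‖x‖ ^ 2) * ‖y‖ ^ 2 ≤ ‖y‖ ^ 2 :=
      mul_le_of_le_one_left (by positivity) m1
    have m3 : 0 ≤ max 0 (1 - ‖x‖ ^ 2) * ‖y‖ ^ 2 := by positivity
    rw [abs_le]
    constructor <;> nlinarith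

/-! ### Superposition of dilates -/

/-- The superposition `∫₁^∞ t^{-b} φ(x / t) dt / t` of the dilates of `φ` at scales larger than
`1`. For `b = N - 2s` and `φ` a bump this is the fundamental solution `|x|^{-(N-2s)}`, smoothed
out near the origin; a second application produces the factor `log |x|`. -/
def scaleAvg (b : ℝ) (φ : EuclideanSpace ℝ (Fin N) → ℝ) (x : EuclideanSpace ℝ (Fin N)) : ℝ :=
  ∫ t in Ioi (1 : ℝ), t ^ (-b - 1) * φ (t⁻¹ • x)

lemma integrableOn_rpow_Ioi_one {b : ℝ} (hb : 0 < b) :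
    IntegrableOn (fun t : ℝ => t ^ (-b - 1)) (Ioi 1) :=
  integrableOn_Ioi_rpow_of_lt (by linarith) zero_lt_one

lemma integral_rpow_Ioi {b c : ℝ} (hb : 0 < b) (hc : 0 < c) :
    ∫ t in Ioi c, t ^ (-b - 1) = c ^ (-b) / b := by
  rw [integral_Ioi_rpow_of_lt (by linarith) hc]
  rw [sub_add_cancel]; field_simp

lemma integrableOn_scaleAvg {b B : ℝ} (hb : 0 < b) {φ : EuclideanSpace ℝ (Fin N) → ℝ}
    (hφ : Continuous φ) (hB : ∀ x, |φ x| ≤ B) (x : EuclideanSpace ℝ (Fin N)) :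
    IntegrableOn (fun t : ℝ => t ^ (-b - 1) * φ (t⁻¹ • x)) (Ioi 1) := by
  refine ((integrableOn_rpow_Ioi_one hb).mul_const B).mono' ?_ ?_
  · have : Measurable fun t : ℝ => φ (t⁻¹ • x) := hφ.measurable.comp (by fun_prop)
    exact Measurable.aestronglyMeasurable (by fun_prop)
  · refine (ae_restrict_iff' measurableSet_Ioi).2 (Eventually.of_forall fun t ht => ?_)
    have : (0:ℝ) < t := zero_lt_one.trans ht
    rw [norm_mul, Real.norm_of_nonneg (by positivity)]
    gcongr
    exact hB _

lemma secondDiff_scaleAvg {b B : ℝ} (hb : 0 < b) {φ : EuclideanSpace ℝ (Fin N) → ℝ}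
    (hφ : Continuous φ) (hB : ∀ x, |φ x| ≤ B) (x y : EuclideanSpace ℝ (Fin N)) :
    secondDiff (scaleAvg b φ) x y =
      ∫ t in Ioi (1 : ℝ), t ^ (-b - 1) * secondDiff (fun z => φ (t⁻¹ • z)) x y := by
  unfold secondDiff scaleAvg
  rw [← integral_const_mul, ← integral_sub, ← integral_sub]
  · congr 1; ext t; ring
  · exact ((integrableOn_scaleAvg hb hφ hB x).const_mul 2).sub (integrableOn_scaleAvg hb hφ hB _)
  · exact integrableOn_scaleAvg hb hφ hB _
  · exact (integrableOn_scaleAvg hb hφ hB x).const_mul 2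
  · exact integrableOn_scaleAvg hb hφ hB _

lemma HasSecondDiffBound.comp_smul {φ : EuclideanSpace ℝ (Fin N) → ℝ} {B : ℝ}
    (h : HasSecondDiffBound φ B) {t : ℝ} (ht : 1 < t) :
    HasSecondDiffBound (fun z => φ (t⁻¹ • z)) B := by
  have hc := h.continuous
  refine ⟨by fun_prop, fun x => h.abs_le _, fun x y => ?_⟩
  have e : secondDiff (fun z => φ (t⁻¹ • z)) x y = secondDiff φ (t⁻¹ • x) (t⁻¹ • y) := by
    simp [secondDiff, smul_add, smul_sub]
  rw [e]
  refine (h.secondDiff_le _ _).trans ?_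
  have := h.nonneg
  have : ‖t⁻¹ • y‖ ≤ ‖y‖ := by
    rw [norm_smul, Real.norm_of_nonneg (by positivity)]
    exact mul_le_of_le_one_left (norm_nonneg _) (inv_le_one_of_one_le₀ ht.le)
  gcongr

lemma HasSecondDiffBound.scaleAvg {φ : EuclideanSpace ℝ (Fin N) → ℝ} {b B : ℝ}
    (h : HasSecondDiffBound φ B) (hb : 0 < b) :
    HasSecondDiffBound (scaleAvg b φ) (B / b) := by
  have hc := h.continuous
  have hI : ∀ C : ℝ, ∫ t in Ioi (1 : ℝ), t ^ (-b - 1) * C = C / b := by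
    intro C
    rw [integral_mul_const, integral_rpow_Ioi hb zero_lt_one]; simp; field_simp
  have hbd : ∀ x, ∀ᵐ t ∂(volume.restrict (Ioi (1:ℝ))),
      ‖t ^ (-b - 1) * φ (t⁻¹ • x)‖ ≤ t ^ (-b - 1) * B := by
    intro x
    refine (ae_restrict_iff' measurableSet_Ioi).2 (Eventually.of_forall fun t ht => ?_)
    have : (0:ℝ) < t := zero_lt_one.trans ht
    rw [norm_mul, Real.norm_of_nonneg (by positivity)]
    gcongr
    exact h.abs_le _
  refine ⟨?_, fun x => ?_, fun x y => ?_⟩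
  · refine continuous_of_dominated (fun x => (integrableOn_scaleAvg hb hc h.abs_le x).1) hbd
      ((integrableOn_rpow_Ioi_one hb).mul_const B) (Eventually.of_forall fun t => ?_)
    fun_prop
  · have := norm_integral_le_of_norm_le ((integrableOn_rpow_Ioi_one hb).mul_const B) (hbd x)
    rwa [hI] at this
  · rw [secondDiff_scaleAvg hb hc h.abs_le]
    have := norm_integral_le_of_norm_le (μ := volume.restrict (Ioi (1:ℝ)))
      (f := fun t => t ^ (-b - 1) * secondDiff (fun z => φ (t⁻¹ • z)) x y)
      ((integrableOn_rpow_Ioi_one hb).mul_const (B * min 1 (‖y‖ ^ 2))) ?_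
    · rw [hI] at this
      rw [div_mul_eq_mul_div]; exact this
    · refine (ae_restrict_iff' measurableSet_Ioi).2 (Eventually.of_forall fun t ht => ?_)
      have h0 : (0:ℝ) < t := zero_lt_one.trans ht
      rw [norm_mul, Real.norm_of_nonneg (by positivity)]
      gcongr
      exact (h.comp_smul ht).secondDiff_le x y

/-- The fractional Laplacian commutes with the superposition of dilates, up to the scaling
exponent. Since only scales `t > 1` occur, `|y|^{-N-2s} min(1, |y|²)` times a power of `t`
dominates the double integral. -/
lemma symFracLap_scaleAvg (hN : 0 < N) (hs : 0 < s) (hs1 : s < 1) (hNs : 2 * s < N)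
    {φ : EuclideanSpace ℝ (Fin N) → ℝ} {B : ℝ}
    (h : HasSecondDiffBound φ B) (x : EuclideanSpace ℝ (Fin N)) :
    symFracLap s (scaleAvg (N - 2 * s) φ) x =
      ∫ t in Ioi (1 : ℝ), t ^ (-(N : ℝ) - 1) * symFracLap s φ (t⁻¹ • x) := by
  have hb : 0 < (N : ℝ) - 2 * s := by linarith
  have hc := h.continuous
  set F : EuclideanSpace ℝ (Fin N) → ℝ → ℝ := fun y t =>
    t ^ (-((N : ℝ) - 2 * s) - 1) * secondDiff (fun z => φ (t⁻¹ • z)) x y /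
      ‖y‖ ^ ((N : ℝ) + 2 * s) with hF
  have hm : Measurable (Function.uncurry F) := by
    have m1 : Measurable fun p : EuclideanSpace ℝ (Fin N) × ℝ => φ (p.2⁻¹ • x) :=
      hc.measurable.comp (by fun_prop)
    have m2 : Measurable fun p : EuclideanSpace ℝ (Fin N) × ℝ => φ (p.2⁻¹ • (x + p.1)) :=
      hc.measurable.comp (by fun_prop)
    have m3 : Measurable fun p : EuclideanSpace ℝ (Fin N) × ℝ => φ (p.2⁻¹ • (x - p.1)) :=
      hc.measurable.comp (by fun_prop)
    simp only [hF, Function.uncurry_def, secondDiff]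
    fun_prop
  have hint : Integrable (Function.uncurry F) (volume.prod (volume.restrict (Ioi 1))) := by
    refine (((integrable_kernel (N := N) hN hs hs1).const_mul B).mul_prod
      (integrableOn_rpow_Ioi_one hb)).mono' hm.aestronglyMeasurable ?_
    have : ∀ᵐ p : EuclideanSpace ℝ (Fin N) × ℝ ∂(volume.prod (volume.restrict (Ioi 1))),
        p.2 ∈ Ioi (1 : ℝ) :=
      Measure.quasiMeasurePreserving_snd.ae (ae_restrict_mem measurableSet_Ioi)
    filter_upwards [this] with p hp
    have h0 : (0:ℝ) < p.2 := zero_lt_one.trans hp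
    have := (h.comp_smul hp).norm_integrand_le (s := s) x p.1
    simp only [hF, Function.uncurry_def]
    rw [mul_div_assoc, norm_mul, Real.norm_of_nonneg (by positivity), mul_comm]
    gcongr
  have hswap := integral_integral_swap hint
  have h1 : ∀ y, ∫ t in Ioi (1:ℝ), F y t =
      secondDiff (scaleAvg (N - 2 * s) φ) x y / ‖y‖ ^ ((N : ℝ) + 2 * s) := by
    intro y
    rw [secondDiff_scaleAvg hb hc h.abs_le, ← integral_div]
  simp only [h1] at hswap
  rw [symFracLap, hswap, ← integral_const_mul]
  refine setIntegral_congr_fun measurableSet_Ioi fun t ht => ?_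
  have h0 : (0:ℝ) < t := zero_lt_one.trans ht
  have h2 := symFracLap_comp_smul (s := s) φ h0 x
  simp only [hF, mul_div_assoc]
  rw [integral_const_mul, mul_left_comm]
  have h3 : t ^ (-(N : ℝ) - 1) = t ^ (-((N : ℝ) - 2 * s) - 1) * t ^ (-(2 * s)) := by
    rw [← Real.rpow_add h0]; congr 1; ring
  rw [h3, mul_assoc, ← h2, symFracLap]

/-! ### The fractional Laplacian of the bump -/

lemma integrable_bump : Integrable (bump : EuclideanSpace ℝ (Fin N) → ℝ) := by
  refine continuous_bump.integrable_of_hasCompactSupport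
    (HasCompactSupport.of_support_subset_isCompact (isCompact_closedBall 0 1) fun x hx => ?_)
  by_contra h
  exact hx (bump_eq_zero (by simpa using (not_le.1 (by simpa using h)).le))

/-- Away from its support, `(-Δ)^s` of the bump is minus the convolution of the bump with the
kernel, hence decays like `|x|^{-N-2s}`. -/
lemma exists_symFracLap_bump_decay (hN : 0 < N) (hs : 0 < s) (hs1 : s < 1) :
    ∃ C > 0, ∀ x : EuclideanSpace ℝ (Fin N), 2 ≤ ‖x‖ →
      |symFracLap s bump x| ≤ C * ‖x‖ ^ (-((N : ℝ) + 2 * s)) := by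
  have hI : 0 ≤ ∫ y : EuclideanSpace ℝ (Fin N), bump y := integral_nonneg bump_nonneg
  refine ⟨2 ^ ((N : ℝ) + 2 * s) * (∫ y : EuclideanSpace ℝ (Fin N), bump y) + 1, by positivity,
    fun x hx => ?_⟩
  have h0 : 0 < ‖x‖ := by linarith
  have hpt : ∀ y, ‖secondDiff bump x y / ‖y‖ ^ ((N : ℝ) + 2 * s)‖ ≤
      (bump (x + y) + bump (x - y)) * (2 ^ ((N : ℝ) + 2 * s) * ‖x‖ ^ (-((N : ℝ) + 2 * s))) := by
    intro y
    have b1 := bump_nonneg (x + y)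
    have b2 := bump_nonneg (x - y)
    rcases le_or_gt (‖x‖ / 2) ‖y‖ with hy | hy
    · have e : (2:ℝ) ^ ((N : ℝ) + 2 * s) * ‖x‖ ^ (-((N : ℝ) + 2 * s)) =
        1 / (‖x‖ / 2) ^ ((N : ℝ) + 2 * s) := by
        rw [Real.div_rpow h0.le zero_le_two, Real.rpow_neg h0.le]; field_simp
      rw [e, norm_div, Real.norm_of_nonneg (by positivity : 0 ≤ ‖y‖ ^ ((N : ℝ) + 2 * s)),
        mul_one_div, secondDiff, bump_eq_zero (by linarith : 1 ≤ ‖x‖), Real.norm_eq_abs]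
      have : |2 * 0 - bump (x + y) - bump (x - y)| = bump (x + y) + bump (x - y) := by
        rw [abs_of_nonpos (by linarith)]; ring
      rw [this]
      gcongr
    · have h1 : 1 ≤ ‖x + y‖ := by
        have := norm_sub_norm_le x (-y); rw [sub_neg_eq_add, norm_neg] at this; linarith
      have h2 : 1 ≤ ‖x - y‖ := by have := norm_sub_norm_le x y; linarith
      rw [secondDiff, bump_eq_zero h1, bump_eq_zero h2, bump_eq_zero (by linarith)]
      simp
  have hi : Integrable fun y => bump (x + y) + bump (x - y) :=
    (integrable_bump.comp_add_left x).add (integrable_bump.comp_sub_left x)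
  have h := norm_integral_le_of_norm_le (hi.mul_const _) (Eventually.of_forall hpt)
  rw [integral_mul_const, integral_add (integrable_bump.comp_add_left x)
    (integrable_bump.comp_sub_left x), integral_add_left_eq_self bump x,
    integral_sub_left_eq_self bump volume x, Real.norm_eq_abs] at h
  rw [symFracLap, abs_mul, abs_of_nonneg (by norm_num : (0 : ℝ) ≤ 1 / 2)]
  have : 0 ≤ ‖x‖ ^ (-((N : ℝ) + 2 * s)) := by positivity
  nlinarith

lemma symFracLap_comp_isometry (A : EuclideanSpace ℝ (Fin N) ≃ₗᵢ[ℝ] EuclideanSpace ℝ (Fin N))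
    (φ : EuclideanSpace ℝ (Fin N) → ℝ) (x : EuclideanSpace ℝ (Fin N)) :
    symFracLap s φ (A x) = symFracLap s (φ ∘ A) x := by
  unfold symFracLap
  rw [← A.measurePreserving.integral_comp' (f := A.toMeasurableEquiv)]
  simp [secondDiff]

lemma symFracLap_bump_eq_of_norm_eq {x y : EuclideanSpace ℝ (Fin N)} (h : ‖x‖ = ‖y‖) :
    symFracLap s bump x = symFracLap s bump y := by
  have h1 := Submodule.reflection_sub h
  rw [← h1, symFracLap_comp_isometry]
  congr 1
  ext z
  simp [bump]

lemma exists_integral_abs_secondDiff_bump_le :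
    ∃ C : ℝ, ∀ y : EuclideanSpace ℝ (Fin N),
      ∫ x : EuclideanSpace ℝ (Fin N), |secondDiff bump x y| ≤ C * min 1 (‖y‖ ^ 2) := by
  set I := ∫ y : EuclideanSpace ℝ (Fin N), bump y with hI
  have hI0 : 0 ≤ I := integral_nonneg bump_nonneg
  set V := volume.real (ball (0 : EuclideanSpace ℝ (Fin N)) 2) with hV
  have hV0 : 0 ≤ V := measureReal_nonneg
  refine ⟨4 * I + 54 * V, fun y => ?_⟩
  rcases le_or_gt 1 ‖y‖ with hy | hy
  · rw [min_eq_left (by nlinarith)]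
    have hi : Integrable fun x : EuclideanSpace ℝ (Fin N) =>
        2 * bump x + bump (x + y) + bump (x - y) :=
      ((integrable_bump.const_mul 2).add (integrable_bump.comp_add_right y)).add
        (integrable_bump.comp_sub_right y)
    have h := norm_integral_le_of_norm_le (f := fun x => |secondDiff bump x y|) hi
      (Eventually.of_forall fun x => ?_)
    · rw [integral_add, integral_add, integral_const_mul, integral_add_right_eq_self bump y,
        integral_sub_right_eq_self bump y, ← hI] at h
      · linarith [le_abs_self (∫ x : EuclideanSpace ℝ (Fin N), |secondDiff bump x y|),
          Real.norm_eq_abs (∫ x : EuclideanSpace ℝ (Fin N), |secondDiff bump x y|)]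
      · exact integrable_bump.const_mul 2
      · exact integrable_bump.comp_add_right y
      · exact (integrable_bump.const_mul 2).add (integrable_bump.comp_add_right y)
      · exact integrable_bump.comp_sub_right y
    · rw [Real.norm_eq_abs, abs_abs, secondDiff, abs_le]
      constructor <;> linarith [bump_nonneg x, bump_nonneg (x + y), bump_nonneg (x - y)]
  · rw [min_eq_right (by nlinarith [norm_nonneg y])]
    have hi : Integrable ((ball (0 : EuclideanSpace ℝ (Fin N)) 2).indicator
        fun _ => 54 * ‖y‖ ^ 2) :=
      (integrable_indicator_iff measurableSet_ball).2
        (integrableOn_const (measure_ball_lt_top.ne))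
    have h := norm_integral_le_of_norm_le (f := fun x => |secondDiff bump x y|) hi
      (Eventually.of_forall fun x => ?_)
    · rw [integral_indicator measurableSet_ball, setIntegral_const, ← hV, smul_eq_mul] at h
      have : 0 ≤ I * ‖y‖ ^ 2 := by positivity
      linarith [le_abs_self (∫ x : EuclideanSpace ℝ (Fin N), |secondDiff bump x y|),
          Real.norm_eq_abs (∫ x : EuclideanSpace ℝ (Fin N), |secondDiff bump x y|)]
    · rw [Real.norm_eq_abs, abs_abs]
      by_cases hx : x ∈ ball (0 : EuclideanSpace ℝ (Fin N)) 2
      · rw [indicator_of_mem hx]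
        refine (hasSecondDiffBound_bump.secondDiff_le x y).trans ?_
        gcongr
        exact min_le_right _ _
      · rw [indicator_of_notMem hx]
        have hx : 2 ≤ ‖x‖ := by simpa using hx
        have h1 : 1 ≤ ‖x + y‖ := by
          have := norm_sub_norm_le x (-y); rw [sub_neg_eq_add, norm_neg] at this; linarith
        have h2 : 1 ≤ ‖x - y‖ := by have := norm_sub_norm_le x y; linarith
        rw [secondDiff, bump_eq_zero h1, bump_eq_zero h2, bump_eq_zero (by linarith)]
        simp

lemma integrable_secondDiff_bump (y : EuclideanSpace ℝ (Fin N)) :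
    Integrable fun x => secondDiff bump x y :=
  ((integrable_bump.const_mul 2).sub (integrable_bump.comp_add_right y)).sub
        (integrable_bump.comp_sub_right y)

lemma integral_secondDiff_bump (y : EuclideanSpace ℝ (Fin N)) :
    ∫ x, secondDiff bump x y = 0 := by
  unfold secondDiff
  rw [integral_sub, integral_sub, integral_const_mul, integral_add_right_eq_self bump y,
        integral_sub_right_eq_self bump y]
  · ring
  · exact integrable_bump.const_mul 2
  · exact integrable_bump.comp_add_right y
  · exact (integrable_bump.const_mul 2).sub (integrable_bump.comp_add_right y)
  · exact integrable_bump.comp_sub_right y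

lemma integrable_prod_secondDiff_bump (hN : 0 < N) (hs : 0 < s) (hs1 : s < 1) :
    Integrable (Function.uncurry fun x y : EuclideanSpace ℝ (Fin N) =>
      secondDiff bump x y / ‖y‖ ^ ((N : ℝ) + 2 * s)) (volume.prod volume) := by
  have hm : Measurable (Function.uncurry fun x y : EuclideanSpace ℝ (Fin N) =>
      secondDiff bump x y / ‖y‖ ^ ((N : ℝ) + 2 * s)) := by
    have := (continuous_bump (N := N)).secondDiff.measurable
    simp only [Function.uncurry_def]
    fun_prop
  rw [integrable_prod_iff' hm.aestronglyMeasurable]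
  refine ⟨Eventually.of_forall fun y =>
    (integrable_secondDiff_bump y).div_const (‖y‖ ^ ((N : ℝ) + 2 * s)), ?_⟩
  obtain ⟨C, hC⟩ := exists_integral_abs_secondDiff_bump_le (N := N)
  refine ((integrable_kernel (N := N) hN hs hs1).const_mul C).mono' ?_ ?_
  · exact (hm.norm.stronglyMeasurable.integral_prod_left').aestronglyMeasurable
  · refine Eventually.of_forall fun y => ?_
    simp only [Function.uncurry_def, norm_div]
    rw [integral_div, Real.norm_of_nonneg (by positivity : 0 ≤ ‖y‖ ^ ((N : ℝ) + 2 * s)), norm_div,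
      Real.norm_of_nonneg (by positivity : 0 ≤ ‖y‖ ^ ((N : ℝ) + 2 * s)), ← mul_div_assoc]
    gcongr
    rw [Real.norm_of_nonneg (integral_nonneg fun x => norm_nonneg _)]
    exact hC y

lemma integrable_symFracLap_bump (hN : 0 < N) (hs : 0 < s) (hs1 : s < 1) :
    Integrable (symFracLap s (bump : EuclideanSpace ℝ (Fin N) → ℝ)) :=
  (integrable_prod_secondDiff_bump hN hs hs1).integral_prod_left.const_mul (1 / 2)

/-- The fractional Laplacian of the bump has integral zero: by Fubini, because every second
difference has integral zero by translation invariance. -/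
lemma integral_symFracLap_bump (hN : 0 < N) (hs : 0 < s) (hs1 : s < 1) :
    ∫ x, symFracLap s (bump : EuclideanSpace ℝ (Fin N) → ℝ) x = 0 := by
  unfold symFracLap
  rw [integral_const_mul, integral_integral_swap (integrable_prod_secondDiff_bump hN hs hs1)]
  simp [integral_div, integral_secondDiff_bump]

/-- Integrating `(-Δ)^s` of the bump over all scales along a ray gives zero: in polar coordinates
this is the vanishing of its integral over the space. It says that `|x|^{-(N-2s)}`, the
superposition of all dilates, is `s`-harmonic off the origin. -/
lemma scale_integral_symFracLap_bump (hN : 0 < N) (hs : 0 < s) (hs1 : s < 1)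
    {x : EuclideanSpace ℝ (Fin N)} (hx : x ≠ 0) :
    IntegrableOn (fun t : ℝ => t ^ (-(N : ℝ) - 1) * symFracLap s bump (t⁻¹ • x)) (Ioi 0) ∧
    ∫ t in Ioi (0 : ℝ), t ^ (-(N : ℝ) - 1) * symFracLap s bump (t⁻¹ • x) = 0 := by
  have := euclidean_nontrivial hN
  have hx0 : 0 < ‖x‖ := norm_pos_iff.2 hx
  -- by rotation invariance the fractional Laplacian of the bump is `G` of the norm
  set e := ‖x‖⁻¹ • x with he
  have hen : ‖e‖ = 1 := by rw [he, norm_smul, norm_inv, norm_norm, inv_mul_cancel₀ hx0.ne']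
  set G : ℝ → ℝ := fun r => symFracLap s bump (r • e) with hG
  have hrad : ∀ y : EuclideanSpace ℝ (Fin N), symFracLap s bump y = G ‖y‖ := fun y =>
    symFracLap_bump_eq_of_norm_eq (by rw [norm_smul, hen]; simp)
  have i1 : Integrable fun y : EuclideanSpace ℝ (Fin N) => G ‖y‖ :=
    (integrable_symFracLap_bump hN hs hs1).congr (Eventually.of_forall hrad)
  have i2 : ∫ y : EuclideanSpace ℝ (Fin N), G ‖y‖ = 0 := by
    rw [← integral_symFracLap_bump (N := N) hN hs hs1]
    exact integral_congr_ae (Eventually.of_forall fun y => (hrad y).symm)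
  rw [integrable_fun_norm_addHaar volume] at i1
  rw [integral_fun_norm_addHaar volume] at i2
  simp only [finrank_euclideanSpace, Fintype.card_fin, smul_eq_mul, nsmul_eq_mul] at i1 i2
  have hvol : volume.real (ball (0 : EuclideanSpace ℝ (Fin N)) 1) ≠ 0 :=
    (ENNReal.toReal_pos (measure_ball_pos volume _ one_pos).ne' measure_ball_lt_top.ne).ne'
  have i3 : ∫ r in Ioi (0 : ℝ), r ^ (N - 1) * G r = 0 := by
    have : (N : ℝ) ≠ 0 := by positivity
    simpa [this, hvol] using i2
  have hH : ∀ r : ℝ, r ^ (N - 1) * G (‖x‖ * r) =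
      (‖x‖ ^ (N - 1))⁻¹ * ((‖x‖ * r) ^ (N - 1) * G (‖x‖ * r)) := by
    intro r; rw [mul_pow]; field_simp
  have j1 : IntegrableOn (fun r : ℝ => r ^ (N - 1) * G (‖x‖ * r)) (Ioi 0) := by
    simp only [hH]
    refine Integrable.const_mul ?_ _
    exact (integrableOn_Ioi_comp_mul_left_iff (fun r => r ^ (N - 1) * G r) 0 hx0).2 (by simpa)
  have j2 : ∫ r in Ioi (0 : ℝ), r ^ (N - 1) * G (‖x‖ * r) = 0 := by
    simp only [hH]
    rw [integral_const_mul, integral_comp_mul_left_Ioi (fun r => r ^ (N - 1) * G r) 0 hx0]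
    simp [i3]
  -- the substitution `r = 1 / t` turns the integral over scales into a radial one
  have hK : ∀ t ∈ Ioi (0 : ℝ), (|(-1 : ℝ)| * t ^ ((-1 : ℝ) - 1)) •
      ((t ^ (-1 : ℝ)) ^ (N - 1) * G (‖x‖ * t ^ (-1 : ℝ))) =
      t ^ (-(N : ℝ) - 1) * symFracLap s bump (t⁻¹ • x) := by
    intro t ht
    have ht : 0 < t := ht
    have hN' : ((N - 1 : ℕ) : ℝ) = N - 1 := by rw [Nat.cast_sub hN]; simp
    have e1 : (‖x‖ * t ^ (-1 : ℝ)) • e = t⁻¹ • x := by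
      rw [he, smul_smul, Real.rpow_neg_one]; congr 1; field_simp
    simp only [hG, e1, smul_eq_mul, abs_neg, abs_one, one_mul]
    rw [← mul_assoc, ← Real.rpow_natCast, ← Real.rpow_mul ht.le, ← Real.rpow_add ht, hN']
    congr 2; ring
  constructor
  · exact ((integrableOn_Ioi_comp_rpow_iff (fun r : ℝ => r ^ (N - 1) * G (‖x‖ * r))
      (by norm_num : (-1 : ℝ) ≠ 0)).2 j1).congr_fun hK measurableSet_Ioi
  · rw [← setIntegral_congr_fun measurableSet_Ioi hK,
      integral_comp_rpow_Ioi (fun r : ℝ => r ^ (N - 1) * G (‖x‖ * r)) (by norm_num), j2]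

/-- The smoothed fundamental solution is `s`-harmonic up to `O(|x|^{-N-2s})`: the missing scales
`t ≤ 1` only see the tail of `(-Δ)^s` of the bump. -/
lemma exists_symFracLap_scaleAvg_bump_decay (hN : 0 < N) (hs : 0 < s) (hs1 : s < 1)
    (hNs : 2 * s < N) :
    ∃ C > 0, ∀ x : EuclideanSpace ℝ (Fin N), 2 ≤ ‖x‖ →
      |symFracLap s (scaleAvg (N - 2 * s) bump) x| ≤ C * ‖x‖ ^ (-((N : ℝ) + 2 * s)) := by
  obtain ⟨C, hC, h⟩ := exists_symFracLap_bump_decay (N := N) hN hs hs1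
  refine ⟨C * (1 / (2 * s)), by positivity, fun x hx => ?_⟩
  have hx0 : 0 < ‖x‖ := by linarith
  obtain ⟨h1, h2⟩ := scale_integral_symFracLap_bump (s := s) hN hs hs1 (norm_pos_iff.1 hx0)
  rw [← Ioc_union_Ioi_eq_Ioi zero_le_one, setIntegral_union (by simp) measurableSet_Ioi
    (h1.mono_set Ioc_subset_Ioi_self) (h1.mono_set (Ioi_subset_Ioi zero_le_one))] at h2
  rw [symFracLap_scaleAvg hN hs hs1 hNs hasSecondDiffBound_bump, ← abs_neg,
    neg_eq_of_add_eq_zero_left h2]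
  have hi := intervalIntegral.intervalIntegrable_rpow' (a := 0) (b := 1) (r := 2 * s - 1)
      (by linarith)
  rw [intervalIntegrable_iff_integrableOn_Ioc_of_le zero_le_one] at hi
  have h3 := norm_integral_le_of_norm_le (μ := volume.restrict (Ioc (0:ℝ) 1))
    (f := fun t => t ^ (-(N : ℝ) - 1) * symFracLap s bump (t⁻¹ • x))
    (hi.mul_const (C * ‖x‖ ^ (-((N : ℝ) + 2 * s)))) ?_
  · have hv : ∫ t in Ioc (0 : ℝ) 1, t ^ (2 * s - 1) = 1 / (2 * s) := by
      rw [← intervalIntegral.integral_of_le zero_le_one, integral_rpow (by left; linarith),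
        Real.zero_rpow (by linarith), Real.one_rpow]
      ring
    rw [integral_mul_const, hv] at h3
    refine h3.trans (le_of_eq ?_)
    ring
  · refine (ae_restrict_iff' measurableSet_Ioc).2 (Eventually.of_forall fun t ht => ?_)
    have ht0 := ht.1
    have hn : ‖t⁻¹ • x‖ = ‖x‖ / t := by
      rw [norm_smul, Real.norm_of_nonneg (by positivity)]; field_simp
    have h4 := h (t⁻¹ • x) (by
      rw [hn, le_div_iff₀ ht0]; nlinarith [ht.2])
    rw [norm_mul, Real.norm_of_nonneg (by positivity), Real.norm_eq_abs]
    calc _ ≤ t ^ (-(N : ℝ) - 1) * (C * ‖t⁻¹ • x‖ ^ (-((N : ℝ) + 2 * s))) := by gcongr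
      _ = _ := by
        have : t ^ (2 * s - 1) = t ^ (-(N : ℝ) - 1) * t ^ ((N : ℝ) + 2 * s) := by
          rw [← Real.rpow_add ht0]; congr 1; ring
        rw [hn, Real.div_rpow hx0.le ht0.le, Real.rpow_neg ht0.le, this]
        field_simp

/-! ### Size and regularity of superpositions -/

/-- `φ` is Lipschitz off the origin with a local constant decaying like `|x|^{-β}`. It replaces a
bound on the gradient of `φ`, so that barriers need not be differentiable. -/
def HasLipDecay (φ : EuclideanSpace ℝ (Fin N) → ℝ) (β C : ℝ) : Prop :=
  ∀ x y, x ≠ 0 → y ≠ 0 → |φ x - φ y| ≤ C * min ‖x‖ ‖y‖ ^ (-β) * ‖x - y‖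

lemma hasLipDecay_bump {β : ℝ} (hβ : 0 ≤ β) :
    HasLipDecay (bump : EuclideanSpace ℝ (Fin N) → ℝ) β 4 := by
  intro x y hx hy
  have hm : 0 < min ‖x‖ ‖y‖ := lt_min (norm_pos_iff.2 hx) (norm_pos_iff.2 hy)
  rcases le_or_gt 1 (min ‖x‖ ‖y‖) with h | h
  · rw [bump_eq_zero (h.trans (min_le_left _ _)), bump_eq_zero (h.trans (min_le_right _ _))]
    simp; positivity
  · have h1 : 1 ≤ min ‖x‖ ‖y‖ ^ (-β) :=
      Real.one_le_rpow_of_pos_of_le_one_of_nonpos hm h.le (by linarith)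
    refine (abs_bump_sub_le x y).trans ?_
    gcongr
    linarith

lemma norm_inv_smul {t : ℝ} (ht : 0 < t) (x : EuclideanSpace ℝ (Fin N)) :
    ‖t⁻¹ • x‖ = ‖x‖ / t := by
  rw [norm_smul, Real.norm_of_nonneg (by positivity)]; field_simp

/-- The restriction `β < b + 1` makes the integral over scales converge, so that the decay
exponent is not affected. -/
lemma HasLipDecay.scaleAvg {φ : EuclideanSpace ℝ (Fin N) → ℝ} {b β B C : ℝ}
    (h : HasLipDecay φ β C) (hb : 0 < b) (hβ : β < b + 1) (hc : Continuous φ)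
    (hB : ∀ x, |φ x| ≤ B) :
    HasLipDecay (scaleAvg b φ) β (C / (b + 1 - β)) := by
  intro x y hx hy
  have hx0 := norm_pos_iff.2 hx
  have hy0 := norm_pos_iff.2 hy
  have hm : 0 < min ‖x‖ ‖y‖ := lt_min hx0 hy0
  have e : _root_.scaleAvg b φ x - _root_.scaleAvg b φ y =
      ∫ t in Ioi (1 : ℝ), t ^ (-b - 1) * (φ (t⁻¹ • x) - φ (t⁻¹ • y)) := by
    unfold _root_.scaleAvg
    rw [← integral_sub (integrableOn_scaleAvg hb hc hB x) (integrableOn_scaleAvg hb hc hB y)]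
    simp only [mul_sub]
  rw [e]
  have h3 := norm_integral_le_of_norm_le (μ := volume.restrict (Ioi (1:ℝ)))
    (f := fun t => t ^ (-b - 1) * (φ (t⁻¹ • x) - φ (t⁻¹ • y)))
    ((integrableOn_rpow_Ioi_one (b := b + 1 - β) (by linarith)).mul_const
      (C * min ‖x‖ ‖y‖ ^ (-β) * ‖x - y‖)) ?_
  · rw [integral_mul_const, integral_rpow_Ioi (by linarith) zero_lt_one, Real.one_rpow] at h3
    refine h3.trans (le_of_eq ?_)
    ring
  · refine (ae_restrict_iff' measurableSet_Ioi).2 (Eventually.of_forall fun t ht => ?_)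
    have ht0 : (0:ℝ) < t := zero_lt_one.trans ht
    have ht1 : t⁻¹ ≠ 0 := by positivity
    have h4 := h (t⁻¹ • x) (t⁻¹ • y) (smul_ne_zero ht1 hx) (smul_ne_zero ht1 hy)
    rw [norm_mul, Real.norm_of_nonneg (by positivity), Real.norm_eq_abs]
    calc _ ≤ t ^ (-b - 1) * (C * min ‖t⁻¹ • x‖ ‖t⁻¹ • y‖ ^ (-β) * ‖t⁻¹ • x - t⁻¹ • y‖) := by
          gcongr
      _ = _ := by
        rw [← smul_sub, norm_inv_smul ht0, norm_inv_smul ht0, norm_inv_smul ht0,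
          min_div_div_right ht0.le, Real.div_rpow hm.le ht0.le]
        have : t ^ (-(b + 1 - β) - 1) = t ^ (-b - 1) * (t ^ (-β))⁻¹ * t⁻¹ := by
          rw [← Real.rpow_neg_one t, ← Real.rpow_neg ht0.le, ← Real.rpow_add ht0,
            ← Real.rpow_add ht0]; congr 1; ring
        rw [this]
        field_simp

lemma scaleAvg_nonneg {b : ℝ} {φ : EuclideanSpace ℝ (Fin N) → ℝ} (h : ∀ x, 0 ≤ φ x)
    (x : EuclideanSpace ℝ (Fin N)) : 0 ≤ scaleAvg b φ x := by
  refine setIntegral_nonneg measurableSet_Ioi fun t ht => ?_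
  have ht0 : (0:ℝ) < t := zero_lt_one.trans ht
  exact mul_nonneg (by positivity) (h _)

lemma scaleAvg_bump_le {b : ℝ} (hb : 0 < b) {x : EuclideanSpace ℝ (Fin N)} (hx : 1 ≤ ‖x‖) :
    scaleAvg b bump x ≤ ‖x‖ ^ (-b) / b := by
  have hx0 : 0 < ‖x‖ := by linarith
  have e : scaleAvg b bump x = ∫ t in Ioi ‖x‖, t ^ (-b - 1) * bump (t⁻¹ • x) := by
    refine setIntegral_eq_of_subset_of_forall_sdiff_eq_zero measurableSet_Ioi
      (Ioi_subset_Ioi hx) fun t ht => ?_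
    have ht0 : (0:ℝ) < t := zero_lt_one.trans ht.1
    have : t ≤ ‖x‖ := not_lt.1 ht.2
    rw [bump_eq_zero, mul_zero]
    rw [norm_inv_smul ht0, le_div_iff₀ ht0]; linarith
  rw [e, ← integral_rpow_Ioi hb hx0]
  refine setIntegral_mono_on ((integrableOn_scaleAvg hb continuous_bump
    hasSecondDiffBound_bump.abs_le x).mono_set (Ioi_subset_Ioi hx))
    ((integrableOn_rpow_Ioi_one hb).mono_set (Ioi_subset_Ioi hx)) measurableSet_Ioi fun t ht => ?_
  have ht0 : (0:ℝ) < t := hx0.trans ht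
  exact mul_le_of_le_one_right (by positivity) (bump_le_one _)

lemma le_scaleAvg_bump {b : ℝ} (hb : 0 < b) {x : EuclideanSpace ℝ (Fin N)} (hx : 1 ≤ ‖x‖) :
    2 ^ (-b) / (2 * b) * ‖x‖ ^ (-b) ≤ scaleAvg b bump x := by
  have hx0 : 0 < ‖x‖ := by linarith
  have hsub : Ioi (2 * ‖x‖) ⊆ Ioi 1 := Ioi_subset_Ioi (by linarith)
  have hi := integrableOn_scaleAvg hb continuous_bump hasSecondDiffBound_bump.abs_le x
  calc 2 ^ (-b) / (2 * b) * ‖x‖ ^ (-b) = (∫ t in Ioi (2 * ‖x‖), t ^ (-b - 1)) * (1 / 2) := by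
        rw [integral_rpow_Ioi hb (by positivity), Real.mul_rpow zero_le_two hx0.le]
        field_simp
    _ = ∫ t in Ioi (2 * ‖x‖), t ^ (-b - 1) * (1 / 2) := by rw [integral_mul_const]
    _ ≤ ∫ t in Ioi (2 * ‖x‖), t ^ (-b - 1) * bump (t⁻¹ • x) := by
        refine setIntegral_mono_on (((integrableOn_rpow_Ioi_one hb).mono_set hsub).mul_const _)
          (hi.mono_set hsub) measurableSet_Ioi fun t ht => ?_
        have ht0 : (0:ℝ) < t := zero_lt_one.trans (hsub ht)
        have ht1 : 2 * ‖x‖ < t := ht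
        gcongr
        refine bump_ge ?_
        rw [norm_inv_smul ht0, div_le_iff₀ ht0]; linarith
    _ ≤ _ := by
        refine setIntegral_mono_set hi ?_ hsub.eventuallyLE
        refine (ae_restrict_iff' measurableSet_Ioi).2 (Eventually.of_forall fun t ht => ?_)
        have ht0 : (0:ℝ) < t := zero_lt_one.trans ht
        exact mul_nonneg (by positivity) (bump_nonneg _)

/-- If `φ ≥ c |x|^{-b}` then each scale `1 < t < |x|` contributes `c |x|^{-b} dt / t`, hence the
logarithm. -/
lemma le_scaleAvg_log {b c B : ℝ} (hb : 0 < b) (hc : 0 < c)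
    {φ : EuclideanSpace ℝ (Fin N) → ℝ} (hφ : Continuous φ) (hB : ∀ x, |φ x| ≤ B)
    (h0 : ∀ x, 0 ≤ φ x) (h : ∀ x, 1 ≤ ‖x‖ → c * ‖x‖ ^ (-b) ≤ φ x)
    {x : EuclideanSpace ℝ (Fin N)} (hx : 1 ≤ ‖x‖) :
    c * ‖x‖ ^ (-b) * Real.log ‖x‖ ≤ scaleAvg b φ x := by
  have hx0 : 0 < ‖x‖ := by linarith
  have hi := integrableOn_scaleAvg hb hφ hB x
  have hinv : IntegrableOn (fun t : ℝ => t⁻¹) (Ioc 1 ‖x‖) := by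
    rw [← intervalIntegrable_iff_integrableOn_Ioc_of_le hx]
    exact intervalIntegral.intervalIntegrable_inv (fun t ht => by
      rw [uIcc_of_le hx] at ht; have := ht.1; positivity) continuousOn_id
  have hpos : ∀ t ∈ Ioi (1 : ℝ), 0 ≤ t ^ (-b - 1) * φ (t⁻¹ • x) := fun t ht => by
    have ht0 : (0:ℝ) < t := zero_lt_one.trans ht
    exact mul_nonneg (by positivity) (h0 _)
  calc c * ‖x‖ ^ (-b) * Real.log ‖x‖ = ∫ t in Ioc 1 ‖x‖, c * ‖x‖ ^ (-b) * t⁻¹ := by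
        rw [integral_const_mul, ← intervalIntegral.integral_of_le hx,
          integral_inv_of_pos one_pos hx0, div_one]
    _ ≤ ∫ t in Ioc 1 ‖x‖, t ^ (-b - 1) * φ (t⁻¹ • x) := by
        refine setIntegral_mono_on (hinv.const_mul _) (hi.mono_set Ioc_subset_Ioi_self)
          measurableSet_Ioc fun t ht => ?_
        have ht0 : (0:ℝ) < t := zero_lt_one.trans ht.1
        have h1 := h (t⁻¹ • x) (by rw [norm_inv_smul ht0, le_div_iff₀ ht0]; linarith [ht.2])
        rw [norm_inv_smul ht0, Real.div_rpow hx0.le ht0.le] at h1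
        calc _ = t ^ (-b - 1) * (c * (‖x‖ ^ (-b) / t ^ (-b))) := by
              rw [Real.rpow_sub_one ht0.ne']
              have := (Real.rpow_pos_of_pos ht0 (-b)).ne'
              field_simp
          _ ≤ _ := by gcongr
    _ ≤ _ := by
        refine setIntegral_mono_set hi ?_ Ioc_subset_Ioi_self.eventuallyLE
        exact (ae_restrict_iff' measurableSet_Ioi).2 (Eventually.of_forall hpos)

lemma abs_scaleAvg_le {b α C : ℝ} (hα : α < b) {φ : EuclideanSpace ℝ (Fin N) → ℝ}
    (h : ∀ x, x ≠ 0 → |φ x| ≤ C * ‖x‖ ^ (-α))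
    {x : EuclideanSpace ℝ (Fin N)} (hx : x ≠ 0) :
    |scaleAvg b φ x| ≤ C / (b - α) * ‖x‖ ^ (-α) := by
  have hx0 := norm_pos_iff.2 hx
  have h3 := norm_integral_le_of_norm_le (μ := volume.restrict (Ioi (1:ℝ)))
    (f := fun t => t ^ (-b - 1) * φ (t⁻¹ • x))
    ((integrableOn_rpow_Ioi_one (b := b - α) (by linarith)).mul_const (C * ‖x‖ ^ (-α))) ?_
  · rw [integral_mul_const, integral_rpow_Ioi (by linarith) zero_lt_one, Real.one_rpow] at h3
    refine h3.trans (le_of_eq ?_)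
    ring
  · refine (ae_restrict_iff' measurableSet_Ioi).2 (Eventually.of_forall fun t ht => ?_)
    have ht0 : (0:ℝ) < t := zero_lt_one.trans ht
    have ht1 : t⁻¹ ≠ 0 := by positivity
    have h4 := h (t⁻¹ • x) (smul_ne_zero ht1 hx)
    rw [norm_mul, Real.norm_of_nonneg (by positivity), Real.norm_eq_abs]
    calc _ ≤ t ^ (-b - 1) * (C * ‖t⁻¹ • x‖ ^ (-α)) := by gcongr
      _ = _ := by
        rw [norm_inv_smul ht0, Real.div_rpow hx0.le ht0.le]
        have : t ^ (-(b - α) - 1) = t ^ (-b - 1) * (t ^ (-α))⁻¹ := by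
          rw [← Real.rpow_neg ht0.le, ← Real.rpow_add ht0]; congr 1; ring
        rw [this]
        field_simp

/-- If `(-Δ)^s φ = O(|x|^{-N-2s})`, then the superposition of the dilates of `φ` has fractional
Laplacian at most `C |x|^{-N}`: the integral over scales splits at `t = |x| / 2`. -/
lemma exists_symFracLap_scaleAvg_le (hN : 0 < N) (hs : 0 < s) (hs1 : s < 1) (hNs : 2 * s < N)
    {φ : EuclideanSpace ℝ (Fin N) → ℝ} {B C : ℝ} (hC : 0 ≤ C)
    (h : HasSecondDiffBound φ B)
    (hdec : ∀ x, 2 ≤ ‖x‖ → |symFracLap s φ x| ≤ C * ‖x‖ ^ (-((N : ℝ) + 2 * s))) :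
    ∃ C' > 0, ∀ x : EuclideanSpace ℝ (Fin N), 2 ≤ ‖x‖ →
      symFracLap s (scaleAvg (N - 2 * s) φ) x ≤ C' * ‖x‖ ^ (-(N : ℝ)) := by
  have hN' : (0 : ℝ) < N := by exact_mod_cast hN
  set G := B * ∫ y : EuclideanSpace ℝ (Fin N), min 1 (‖y‖ ^ 2) / ‖y‖ ^ ((N : ℝ) + 2 * s) with hG
  have hGb : ∀ x, |symFracLap s φ x| ≤ G := h.abs_symFracLap_le hN hs hs1
  have hG0 : 0 ≤ G := (abs_nonneg _).trans (hGb 0)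
  refine ⟨C / (2 * s) + G * 2 ^ (N : ℝ) / N + 1, by positivity, fun x hx => ?_⟩
  have hx0 : 0 < ‖x‖ := by linarith
  have hd : 0 < ‖x‖ ^ (-(N : ℝ)) := by positivity
  rw [symFracLap_scaleAvg hN hs hs1 hNs h]
  have hi : IntegrableOn (fun t : ℝ => C * ‖x‖ ^ (-((N : ℝ) + 2 * s)) * t ^ (2 * s - 1))
      (Ioc 0 ‖x‖) := by
    have := intervalIntegral.intervalIntegrable_rpow' (a := 0) (b := ‖x‖) (r := 2 * s - 1)
      (by linarith)
    rw [intervalIntegrable_iff_integrableOn_Ioc_of_le hx0.le] at this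
    exact this.const_mul _
  have hi' : IntegrableOn (fun t : ℝ => t ^ (-(N : ℝ) - 1) * G) (Ioi (‖x‖ / 2)) :=
    (integrableOn_Ioi_rpow_of_lt (by linarith) (by positivity)).mul_const _
  have hI1 : ∫ t in Ioc 0 ‖x‖, C * ‖x‖ ^ (-((N : ℝ) + 2 * s)) * t ^ (2 * s - 1) =
      C / (2 * s) * ‖x‖ ^ (-(N : ℝ)) := by
    rw [integral_const_mul, ← intervalIntegral.integral_of_le hx0.le,
      integral_rpow (by left; linarith), Real.zero_rpow (by linarith), sub_add_cancel, sub_zero]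
    have : ‖x‖ ^ (-(N : ℝ)) = ‖x‖ ^ (-((N : ℝ) + 2 * s)) * ‖x‖ ^ (2 * s) := by
      rw [← Real.rpow_add hx0]; congr 1; ring
    rw [this]; ring
  have hI2 : ∫ t in Ioi (‖x‖ / 2), t ^ (-(N : ℝ) - 1) * G =
      G * 2 ^ (N : ℝ) / N * ‖x‖ ^ (-(N : ℝ)) := by
    rw [integral_mul_const, integral_rpow_Ioi hN' (by positivity), Real.div_rpow hx0.le zero_le_two,
      Real.rpow_neg zero_le_two]
    field_simp
  rw [← integral_indicator measurableSet_Ioc] at hI1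
  rw [← integral_indicator measurableSet_Ioi] at hI2
  have hi := (integrable_indicator_iff measurableSet_Ioc).2 hi
  have hi' := (integrable_indicator_iff measurableSet_Ioi).2 hi'
  have hnn1 : ∀ t, 0 ≤ (Ioc 0 ‖x‖).indicator
      (fun t : ℝ => C * ‖x‖ ^ (-((N : ℝ) + 2 * s)) * t ^ (2 * s - 1)) t := fun t =>
    indicator_nonneg (fun t ht => by have := ht.1; positivity) t
  have hnn2 : ∀ t, 0 ≤ (Ioi (‖x‖ / 2)).indicator
      (fun t : ℝ => t ^ (-(N : ℝ) - 1) * G) t := fun t =>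
    indicator_nonneg (fun t ht => by
      have : 0 < t := (by positivity : 0 < ‖x‖ / 2).trans ht
      positivity) t
  have h3 := norm_integral_le_of_norm_le (μ := volume.restrict (Ioi (1:ℝ)))
    (f := fun t => t ^ (-(N : ℝ) - 1) * symFracLap s φ (t⁻¹ • x)) (hi.add hi').integrableOn ?_
  · have h4 := setIntegral_le_integral (s := Ioi (1:ℝ)) (hi.add hi')
      (Eventually.of_forall fun t => add_nonneg (hnn1 t) (hnn2 t))
    have h5 := integral_add hi hi'
    simp only [Pi.add_apply] at h3 h4
    rw [h5, hI1, hI2] at h4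
    have := (le_abs_self _).trans (h3.trans h4)
    linarith
  · refine (ae_restrict_iff' measurableSet_Ioi).2 (Eventually.of_forall fun t ht => ?_)
    have ht0 : (0:ℝ) < t := zero_lt_one.trans ht
    rw [norm_mul, Real.norm_of_nonneg (by positivity), Real.norm_eq_abs]
    simp only [Pi.add_apply]
    rcases le_or_gt t (‖x‖ / 2) with h2 | h2
    · have h6 := hdec (t⁻¹ • x) (by rw [norm_inv_smul ht0, le_div_iff₀ ht0]; linarith)
      have h7 : t ^ (-(N : ℝ) - 1) * |symFracLap s φ (t⁻¹ • x)| ≤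
          C * ‖x‖ ^ (-((N : ℝ) + 2 * s)) * t ^ (2 * s - 1) := by
        calc _ ≤ t ^ (-(N : ℝ) - 1) * (C * ‖t⁻¹ • x‖ ^ (-((N : ℝ) + 2 * s))) := by gcongr
          _ = _ := by
            have : t ^ (2 * s - 1) = t ^ (-(N : ℝ) - 1) * t ^ ((N : ℝ) + 2 * s) := by
              rw [← Real.rpow_add ht0]; congr 1; ring
            rw [norm_inv_smul ht0, Real.div_rpow hx0.le ht0.le, Real.rpow_neg ht0.le, this]
            field_simp
      have h8 := hnn2 t
      rw [indicator_of_mem (show t ∈ Ioc 0 ‖x‖ from ⟨ht0, by linarith⟩)]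
      linarith
    · have h8 := hnn1 t
      rw [indicator_of_mem (show t ∈ Ioi (‖x‖ / 2) from h2)]
      have h9 : t ^ (-(N : ℝ) - 1) * |symFracLap s φ (t⁻¹ • x)| ≤ t ^ (-(N : ℝ) - 1) * G := by
        gcongr; exact hGb _
      linarith

/-! ### One-sided bounds for the fractional Laplacian -/

lemma HasFracUpper.mono {φ : EuclideanSpace ℝ (Fin N) → ℝ} {x : EuclideanSpace ℝ (Fin N)}
    {l l' : ℝ} (h : HasFracUpper s φ x l) (hl : l ≤ l') : HasFracUpper s φ x l' := by
  intro δ hδ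
  filter_upwards [h δ hδ] with ε hε
  linarith

lemma HasFracUpper.const_mul {φ : EuclideanSpace ℝ (Fin N) → ℝ} {x : EuclideanSpace ℝ (Fin N)}
    {l a : ℝ} (h : HasFracUpper s φ x l) (ha : 0 < a) :
    HasFracUpper s (fun y => a * φ y) x (a * l) := by
  intro δ hδ
  filter_upwards [h (δ / a) (by positivity)] with ε hε
  have e : truncFracLap s (fun y => a * φ y) x ε = a * truncFracLap s φ x ε := by
    unfold truncFracLap
    rw [← integral_const_mul]
    congr 1; ext y; ring
  rw [e]
  calc _ ≤ a * (l + δ / a) := by gcongr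
    _ = _ := by field_simp

/-- Comparison principle for one-sided bounds: the truncated integrals of `ψ` are bounded by `c`
times those of `φ` plus `∫ F`, where the error `F` vanishes near `x`. -/
lemma HasFracUpper.of_le (hN : 0 < N) (hs : 0 < s) (hs1 : s < 1)
    {φ ψ F : EuclideanSpace ℝ (Fin N) → ℝ} {x : EuclideanSpace ℝ (Fin N)} {l B c r I : ℝ}
    (h : HasFracUpper s φ x l) (hc : 0 ≤ c) (hr : 0 < r)
    (hφm : AEStronglyMeasurable φ) (hφB : ∀ x, |φ x| ≤ B)
    (hψm : AEStronglyMeasurable ψ) (hψB : ∀ x, |ψ x| ≤ B)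
    (hF : Integrable F) (hF0 : ∀ y ∈ ball x r, F y = 0) (hFI : ∫ y, F y ≤ I)
    (hle : ∀ y, (ψ x - ψ y) / ‖x - y‖ ^ ((N : ℝ) + 2 * s) ≤
      c * ((φ x - φ y) / ‖x - y‖ ^ ((N : ℝ) + 2 * s)) + F y) :
    HasFracUpper s ψ x (c * l + I) := by
  intro δ hδ
  have hev : ∀ᶠ ε : ℝ in 𝓝[>] 0, ε < r := nhdsWithin_le_nhds (eventually_lt_nhds hr)
  filter_upwards [h (δ / (c + 1)) (by positivity), hev, self_mem_nhdsWithin] with ε hε hεr hε0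
  have hi := integrableOn_trunc hN hs hs1 hε0 hφm hφB x
  have hi' := integrableOn_trunc hN hs hs1 hε0 hψm hψB x
  have hFe : ∫ y in (ball x ε)ᶜ, F y = ∫ y, F y := by
    refine setIntegral_eq_integral_of_forall_compl_eq_zero fun y hy => hF0 y ?_
    exact ball_subset_ball hεr.le (not_not.1 hy)
  have h1 : truncFracLap s ψ x ε ≤ c * truncFracLap s φ x ε + ∫ y, F y := by
    rw [← hFe, truncFracLap, truncFracLap, ← integral_const_mul,
      ← integral_add (hi.const_mul c) hF.integrableOn]
    exact setIntegral_mono hi' ((hi.const_mul c).add hF.integrableOn) hle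
  have h2 : c * truncFracLap s φ x ε ≤ c * (l + δ / (c + 1)) := by gcongr
  have h3 : c * (δ / (c + 1)) ≤ δ := by
    rw [← mul_div_assoc, div_le_iff₀ (by positivity)]; nlinarith
  linarith

lemma HasFracUpper.add (hN : 0 < N) (hs : 0 < s) (hs1 : s < 1)
    {φ ψ : EuclideanSpace ℝ (Fin N) → ℝ} {x : EuclideanSpace ℝ (Fin N)} {l l' B B' : ℝ}
    (h : HasFracUpper s φ x l) (h' : HasFracUpper s ψ x l')
    (hφm : AEStronglyMeasurable φ) (hφB : ∀ x, |φ x| ≤ B)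
    (hψm : AEStronglyMeasurable ψ) (hψB : ∀ x, |ψ x| ≤ B') :
    HasFracUpper s (fun y => φ y + ψ y) x (l + l') := by
  intro δ hδ
  filter_upwards [h (δ / 2) (by positivity), h' (δ / 2) (by positivity), self_mem_nhdsWithin]
    with ε h1 h2 hε
  have e : truncFracLap s (fun y => φ y + ψ y) x ε =
      truncFracLap s φ x ε + truncFracLap s ψ x ε := by
    unfold truncFracLap
    rw [← integral_add (integrableOn_trunc hN hs hs1 hε hφm hφB x)
      (integrableOn_trunc hN hs hs1 hε hψm hψB x)]
    congr 1; ext y; ring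
  rw [e]; linarith

/-- Cutting a bounded nonnegative function off to zero in a ball costs only `O(|x|^{-N-2s})`. This
allows comparison with `u`, which may have infimum zero in the hole. -/
lemma exists_hasFracUpper_indicator (hN : 0 < N) (hs : 0 < s) (hs1 : s < 1)
    {φ : EuclideanSpace ℝ (Fin N) → ℝ} {M R : ℝ} (hφ : Continuous φ) (h0 : ∀ x, 0 ≤ φ x)
    (hM : ∀ x, φ x ≤ M) (hR : 0 < R) :
    ∃ C > 0, ∀ x l, 2 * R ≤ ‖x‖ → HasFracUpper s φ x l →
      HasFracUpper s ({y | R < ‖y‖}.indicator φ) x (l + C * ‖x‖ ^ (-((N : ℝ) + 2 * s))) := by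
  have hM0 : 0 ≤ M := (h0 0).trans (hM 0)
  set V := volume.real (closedBall (0 : EuclideanSpace ℝ (Fin N)) R) with hV
  have hV0 : 0 ≤ V := measureReal_nonneg
  refine ⟨M * 2 ^ ((N : ℝ) + 2 * s) * V + 1, by positivity, fun x l hx h => ?_⟩
  have hx0 : 0 < ‖x‖ := by linarith
  have hms : MeasurableSet {y : EuclideanSpace ℝ (Fin N) | R < ‖y‖} :=
    measurableSet_lt measurable_const measurable_norm
  set q : ℝ := M * 2 ^ ((N : ℝ) + 2 * s) * ‖x‖ ^ (-((N : ℝ) + 2 * s)) with hq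
  have hd : 0 < ‖x‖ ^ (-((N : ℝ) + 2 * s)) := by positivity
  have hxmem : x ∈ {y : EuclideanSpace ℝ (Fin N) | R < ‖y‖} := by
    show R < ‖x‖; linarith
  have key := HasFracUpper.of_le (ψ := {y | R < ‖y‖}.indicator φ)
    (F := (closedBall 0 R).indicator fun _ => q) (B := M) (c := 1) (r := ‖x‖ / 2)
    (I := q * V) hN hs hs1 h zero_le_one (by positivity) hφ.aestronglyMeasurable
    (fun y => by rw [abs_of_nonneg (h0 y)]; exact hM y)
    (hφ.measurable.indicator hms).aestronglyMeasurable
    (fun y => by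
      rw [abs_of_nonneg (indicator_nonneg (fun y _ => h0 y) y)]
      exact (indicator_le_self' (fun y _ => h0 y) y).trans (hM y))
    ((integrable_indicator_iff measurableSet_closedBall).2
      (integrableOn_const measure_closedBall_lt_top.ne))
    ?_ ?_ ?_
  · refine key.mono ?_
    rw [hq]; nlinarith
  · intro y hy
    refine indicator_of_notMem (fun hy' => ?_) _
    have h1 : ‖y‖ ≤ R := by simpa using hy'
    have h2 : ‖y - x‖ < ‖x‖ / 2 := by simpa [dist_eq_norm] using hy
    have := norm_sub_norm_le x y
    rw [norm_sub_rev] at this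
    linarith
  · rw [integral_indicator measurableSet_closedBall, setIntegral_const, smul_eq_mul, mul_comm]
  · intro y
    rw [indicator_of_mem hxmem]
    by_cases hy : R < ‖y‖
    · rw [indicator_of_mem (show y ∈ {y | R < ‖y‖} from hy),
        indicator_of_notMem (by simpa using hy)]
      simp
    · have h1 : ‖y‖ ≤ R := not_lt.1 hy
      rw [indicator_of_notMem (show y ∉ {y | R < ‖y‖} from hy),
        indicator_of_mem (by simpa using h1)]
      have h2 : ‖x‖ / 2 ≤ ‖x - y‖ := by have := norm_sub_norm_le x y; linarith
      have h3 : 0 < ‖x - y‖ := by linarith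
      have h4 : φ y / ‖x - y‖ ^ ((N : ℝ) + 2 * s) ≤ q := by
        calc _ ≤ M / (‖x‖ / 2) ^ ((N : ℝ) + 2 * s) := by
              gcongr; exact hM y
          _ = q := by
            rw [hq, Real.div_rpow hx0.le zero_le_two, Real.rpow_neg hx0.le]; field_simp
      rw [sub_zero, one_mul, sub_div]
      linarith

lemma rpow_convex_tangent {κ X Y : ℝ} (hκ : 0 < κ) (hX : 0 < X) (hY : 0 ≤ Y) :
    X ^ (1 + κ) - Y ^ (1 + κ) ≤ (1 + κ) * X ^ κ * (X - Y) := by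
  have h := one_add_mul_self_le_rpow_one_add (s := Y / X - 1)
    (by have : 0 ≤ Y / X := by positivity
        linarith) (p := 1 + κ) (by linarith)
  rw [add_sub_cancel, Real.div_rpow hY hX.le, le_div_iff₀ (by positivity)] at h
  have e : X ^ (1 + κ) = X * X ^ κ := by rw [Real.rpow_add hX, Real.rpow_one]
  have e2 : (1 + (1 + κ) * (Y / X - 1)) * X ^ (1 + κ) =
      X ^ (1 + κ) - (1 + κ) * X ^ κ * (X - Y) := by
    rw [e]; field_simp; ring
  linarith

/-- Convexity of `X ↦ X^{1+κ}` with a definite gain, when `Y` is much smaller than `X`. -/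
lemma rpow_convex_gain {κ X Y : ℝ} (hκ : 0 < κ) (hX : 0 < X) (hY : 0 ≤ Y)
    (hYX : Y ≤ κ / (2 * (1 + κ)) * X) :
    X ^ (1 + κ) - Y ^ (1 + κ) ≤ (1 + κ) * X ^ κ * (X - Y) - κ / 2 * X ^ (1 + κ) := by
  have e : X ^ (1 + κ) = X * X ^ κ := by rw [Real.rpow_add hX, Real.rpow_one]
  have h1 : 0 ≤ Y ^ (1 + κ) := by positivity
  have h2 : (1 + κ) * Y ≤ κ / 2 * X := by
    calc _ ≤ (1 + κ) * (κ / (2 * (1 + κ)) * X) := by gcongr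
      _ = _ := by field_simp
  have h3 : 0 < X ^ κ := by positivity
  rw [e]
  nlinarith

/-- If `φ` is comparable to `|x|^{-(N-2s)}`, then `φ^{1+κ}` is a strict subsolution up to the term
coming from `(-Δ)^s φ`: by convexity `(-Δ)^s h(φ) ≤ h'(φ) (-Δ)^s φ`, and the difference is at
least a multiple of `φ^{1+κ} |x|^{-2s}`, from a ball of radius `|x|` so far out that `φ` is much
smaller there than at `x`. -/
lemma exists_hasFracUpper_rpow (hN : 0 < N) (hs : 0 < s) (hs1 : s < 1) (hNs : 2 * s < N)
    {φ : EuclideanSpace ℝ (Fin N) → ℝ} {c C B κ : ℝ} (hκ : 0 < κ) (hc : 0 < c) (hC : 0 < C)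
    (hφ : Continuous φ) (h0 : ∀ x, 0 ≤ φ x) (hB : ∀ x, φ x ≤ B)
    (hlow : ∀ x, 1 ≤ ‖x‖ → c * ‖x‖ ^ (-((N : ℝ) - 2 * s)) ≤ φ x)
    (hup : ∀ x, 1 ≤ ‖x‖ → φ x ≤ C * ‖x‖ ^ (-((N : ℝ) - 2 * s))) :
    ∃ c' > 0, ∀ x l, 1 ≤ ‖x‖ → HasFracUpper s φ x l →
      HasFracUpper s (fun y => φ y ^ (1 + κ)) x
        ((1 + κ) * φ x ^ κ * l - c' * ‖x‖ ^ (-((N : ℝ) + κ * (N - 2 * s)))) := by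
  set b := (N : ℝ) - 2 * s with hb
  have hb0 : 0 < b := by linarith
  have hB0 : 0 ≤ B := (h0 0).trans (hB 0)
  set θ := κ / (2 * (1 + κ)) with hθ
  have hθ0 : 0 < θ := by positivity
  -- points at distance at least `M |x|` carry a value at most `θ φ x`
  obtain ⟨M, hM2, hM⟩ : ∃ M : ℝ, 2 ≤ M ∧ C * M ^ (-b) ≤ θ * c := by
    have h1 := (tendsto_rpow_neg_atTop hb0).eventually
      (eventually_le_nhds (show 0 < θ * c / C by positivity))
    obtain ⟨M, h1, h2⟩ := (h1.and (eventually_ge_atTop 2)).exists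
    refine ⟨M, h2, ?_⟩
    rw [le_div_iff₀ hC] at h1; linarith
  have hM0 : 0 < M := by linarith
  set V := volume.real (ball (0 : EuclideanSpace ℝ (Fin N)) 1) with hV
  have hV0 : 0 < V := ENNReal.toReal_pos (measure_ball_pos volume _ one_pos).ne'
    measure_ball_lt_top.ne
  refine ⟨κ / 2 * c ^ (1 + κ) * V * (2 * M) ^ (-((N : ℝ) + 2 * s)), by positivity,
    fun x l hx h => ?_⟩
  have hx0 : 0 < ‖x‖ := by linarith
  have hX : 0 < φ x := lt_of_lt_of_le (by positivity) (hlow x hx)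
  -- the ball of radius `|x|` around `z = 2 M x` lies at distance at least `M |x|` from the origin
  set z : EuclideanSpace ℝ (Fin N) := (2 * M) • x with hz
  have hzn : ‖z‖ = 2 * M * ‖x‖ := by
    rw [hz, norm_smul, Real.norm_of_nonneg (by positivity)]
  have hzx : ‖z - x‖ = (2 * M - 1) * ‖x‖ := by
    rw [hz, show (2 * M) • x - x = (2 * M - 1) • x by rw [sub_smul, one_smul], norm_smul,
      Real.norm_of_nonneg (by linarith)]
  set q : ℝ := κ / 2 * φ x ^ (1 + κ) * ((2 * M) * ‖x‖) ^ (-((N : ℝ) + 2 * s)) with hq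
  have hq0 : 0 < q := by positivity
  have hball : ∀ y ∈ ball z ‖x‖, M * ‖x‖ ≤ ‖y‖ ∧ ‖x‖ ≤ ‖x - y‖ ∧ ‖x - y‖ ≤ 2 * M * ‖x‖ := by
    intro y hy
    have hy : ‖y - z‖ < ‖x‖ := by simpa [dist_eq_norm] using hy
    have h1 := norm_sub_norm_le z (z - y)
    have h2 := norm_sub_norm_le (z - x) (z - y)
    have h3 := norm_sub_le (z - y) (z - x)
    rw [sub_sub_cancel] at h1
    rw [show z - x - (z - y) = -(x - y) by abel, norm_neg] at h2
    rw [show z - y - (z - x) = x - y by abel] at h3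
    rw [norm_sub_rev z y] at h1 h2 h3
    refine ⟨?_, ?_, ?_⟩ <;> nlinarith
  have hvol : volume.real (ball z ‖x‖) = ‖x‖ ^ N * V := by
    rw [measureReal_def, Measure.addHaar_ball_of_pos volume z hx0, ENNReal.toReal_mul,
      ENNReal.toReal_ofReal (by positivity), finrank_euclideanSpace, Fintype.card_fin]
    rfl
  have hbd : ∀ y, φ y ^ (1 + κ) ≤ B ^ (1 + κ) := fun y =>
    Real.rpow_le_rpow (h0 y) (hB y) (by linarith)
  have key := HasFracUpper.of_le (ψ := fun y => φ y ^ (1 + κ))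
    (F := (ball z ‖x‖).indicator fun _ => -q) (B := B + B ^ (1 + κ)) (c := (1 + κ) * φ x ^ κ)
    (r := ‖x‖) (I := -(q * (‖x‖ ^ N * V))) hN hs hs1 h (by positivity) hx0 hφ.aestronglyMeasurable
    (fun y => by
      rw [abs_of_nonneg (h0 y)]
      have : 0 ≤ B ^ (1 + κ) := by positivity
      linarith [hB y])
    (hφ.rpow_const (fun _ => Or.inr (by linarith))).aestronglyMeasurable
    (fun y => by
      rw [abs_of_nonneg (Real.rpow_nonneg (h0 y) _)]
      linarith [hbd y])
    ((integrable_indicator_iff measurableSet_ball).2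
      (integrableOn_const measure_ball_lt_top.ne))
    ?_ ?_ ?_
  · refine key.mono ?_
    rw [sub_eq_add_neg]
    refine add_le_add le_rfl (neg_le_neg ?_)
    have e1 : c ^ (1 + κ) * ‖x‖ ^ (-b * (1 + κ)) ≤ φ x ^ (1 + κ) := by
      rw [Real.rpow_mul hx0.le, ← Real.mul_rpow hc.le (by positivity)]
      exact Real.rpow_le_rpow (by positivity) (hlow x hx) (by linarith)
    have e2 : ‖x‖ ^ (-((N : ℝ) + κ * b)) =
        ‖x‖ ^ (-b * (1 + κ)) * ‖x‖ ^ (-((N : ℝ) + 2 * s)) * ‖x‖ ^ N := by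
      rw [← Real.rpow_natCast, ← Real.rpow_add hx0, ← Real.rpow_add hx0]
      congr 1; rw [hb]; ring
    rw [e2, hq, Real.mul_rpow (by positivity) hx0.le]
    calc _ = κ / 2 * (c ^ (1 + κ) * ‖x‖ ^ (-b * (1 + κ))) * ((2 * M) ^ (-((N : ℝ) + 2 * s)) *
          ‖x‖ ^ (-((N : ℝ) + 2 * s))) * (‖x‖ ^ N * V) := by ring
      _ ≤ _ := by gcongr
  · intro y hy
    refine indicator_of_notMem (fun hy' => ?_) _
    have h1 := (hball y hy').2.1
    have h2 : ‖y - x‖ < ‖x‖ := by simpa [dist_eq_norm] using hy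
    rw [norm_sub_rev] at h2
    linarith
  · rw [integral_indicator measurableSet_ball, setIntegral_const, smul_eq_mul, hvol]
    linarith
  · intro y
    by_cases hy : y ∈ ball z ‖x‖
    · obtain ⟨h1, h2, h3⟩ := hball y hy
      rw [indicator_of_mem hy]
      have hy1 : 1 ≤ ‖y‖ := by nlinarith
      have h4 : φ y ≤ θ * φ x := by
        calc φ y ≤ C * ‖y‖ ^ (-b) := hup y hy1
          _ ≤ C * (M * ‖x‖) ^ (-b) := by
            gcongr ?_ * ?_
            exact Real.rpow_le_rpow_of_nonpos (by positivity) h1 (by linarith)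
          _ = C * M ^ (-b) * ‖x‖ ^ (-b) := by rw [Real.mul_rpow hM0.le hx0.le]; ring
          _ ≤ θ * c * ‖x‖ ^ (-b) := by gcongr
          _ ≤ θ * φ x := by rw [mul_assoc]; gcongr; exact hlow x hx
      have h5 := rpow_convex_gain hκ hX (h0 y) h4
      have hk : 0 < ‖x - y‖ ^ ((N : ℝ) + 2 * s) := Real.rpow_pos_of_pos (by linarith) _
      have h6 : q ≤ κ / 2 * φ x ^ (1 + κ) / ‖x - y‖ ^ ((N : ℝ) + 2 * s) := by
        rw [hq, Real.rpow_neg (by positivity), ← div_eq_mul_inv]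
        gcongr
      have h7 := div_le_div_of_nonneg_right h5 hk.le
      rw [sub_div ((1 + κ) * φ x ^ κ * (φ x - φ y)), mul_div_assoc ((1 + κ) * φ x ^ κ)] at h7
      linarith
    · rw [indicator_of_notMem hy, add_zero, ← mul_div_assoc]
      exact div_le_div_of_nonneg_right (rpow_convex_tangent hκ hX (h0 y)) (by positivity)

lemma HasLipDecay.rpow {φ : EuclideanSpace ℝ (Fin N) → ℝ} {β C B κ : ℝ}
    (h : HasLipDecay φ β C) (hκ : 0 < κ) (h0 : ∀ x, 0 ≤ φ x) (hB : ∀ x, φ x ≤ B) :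
    HasLipDecay (fun y => φ y ^ (1 + κ)) β ((1 + κ) * B ^ κ * C) := by
  have hB0 : 0 ≤ B := (h0 0).trans (hB 0)
  have key : ∀ x y, φ x ^ (1 + κ) - φ y ^ (1 + κ) ≤ (1 + κ) * B ^ κ * |φ x - φ y| := by
    intro x y
    rcases (h0 x).eq_or_lt with hx | hx
    · rw [← hx, Real.zero_rpow (by linarith)]
      have : 0 ≤ φ y ^ (1 + κ) := Real.rpow_nonneg (h0 y) _
      have : 0 ≤ (1 + κ) * B ^ κ * |0 - φ y| := by positivity
      linarith
    · refine (rpow_convex_tangent hκ hx (h0 y)).trans ?_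
      have : φ x ^ κ ≤ B ^ κ := Real.rpow_le_rpow hx.le (hB x) hκ.le
      calc _ ≤ (1 + κ) * φ x ^ κ * |φ x - φ y| := by gcongr; exact le_abs_self _
        _ ≤ _ := by gcongr
  intro x y hx hy
  have h1 : |φ x ^ (1 + κ) - φ y ^ (1 + κ)| ≤ (1 + κ) * B ^ κ * |φ x - φ y| := by
    rw [abs_le]
    refine ⟨?_, key x y⟩
    have := key y x
    rw [abs_sub_comm] at this
    linarith
  calc _ ≤ (1 + κ) * B ^ κ * |φ x - φ y| := h1
    _ ≤ (1 + κ) * B ^ κ * (C * min ‖x‖ ‖y‖ ^ (-β) * ‖x - y‖) := by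
      gcongr; exact h x y hx hy
    _ = _ := by ring

lemma HasLipDecay.add {φ ψ : EuclideanSpace ℝ (Fin N) → ℝ} {β C C' : ℝ}
    (h : HasLipDecay φ β C) (h' : HasLipDecay ψ β C') :
    HasLipDecay (fun y => φ y + ψ y) β (C + C') := by
  intro x y hx hy
  have := abs_add_le (φ x - φ y) (ψ x - ψ y)
  rw [show φ x + ψ x - (φ y + ψ y) = φ x - φ y + (ψ x - ψ y) by ring]
  linarith [h x y hx hy, h' x y hx hy]

/-! ### Barriers -/

/-- A function that can serve as a barrier: continuous, with values in `[0, M]`, vanishing at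
infinity, and with local Lipschitz constant at most `L |x|^{-β}`. -/
structure IsProfile (φ : EuclideanSpace ℝ (Fin N) → ℝ) (β M L : ℝ) : Prop where
  continuous : Continuous φ
  nonneg : ∀ x, 0 ≤ φ x
  le : ∀ x, φ x ≤ M
  tendsto : Tendsto φ (Bornology.cobounded _) (𝓝 0)
  lip_nonneg : 0 ≤ L
  lip : HasLipDecay φ β L

lemma tendsto_of_abs_le_rpow {φ : EuclideanSpace ℝ (Fin N) → ℝ} {α C : ℝ} (hα : 0 < α)
    (h : ∀ x, x ≠ 0 → |φ x| ≤ C * ‖x‖ ^ (-α)) :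
    Tendsto φ (Bornology.cobounded _) (𝓝 0) := by
  have h1 : Tendsto (fun x : EuclideanSpace ℝ (Fin N) => C * ‖x‖ ^ (-α))
      (Bornology.cobounded _) (𝓝 0) := by
    have := ((tendsto_rpow_neg_atTop hα).comp
      (tendsto_norm_cobounded_atTop (E := EuclideanSpace ℝ (Fin N)))).const_mul C
    simpa [Function.comp_def] using this
  refine squeeze_zero_norm' ?_ h1
  filter_upwards [(tendsto_norm_cobounded_atTop (E := EuclideanSpace ℝ (Fin N))).eventually
    (eventually_gt_atTop 0)] with x hx
  exact h x (norm_pos_iff.1 hx)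

lemma abs_scaleAvg_bump_le {b : ℝ} {x : EuclideanSpace ℝ (Fin N)} (hx : x ≠ 0) {α : ℝ}
    (hα0 : 0 ≤ α) (hα : α < b) : |scaleAvg b bump x| ≤ 1 / (b - α) * ‖x‖ ^ (-α) := by
  refine abs_scaleAvg_le hα (fun y hy => ?_) hx
  have hy0 := norm_pos_iff.2 hy
  rw [abs_of_nonneg (bump_nonneg y), one_mul]
  rcases le_or_gt 1 ‖y‖ with h | h
  · rw [bump_eq_zero h]; positivity
  · exact (bump_le_one y).trans
      (Real.one_le_rpow_of_pos_of_le_one_of_nonpos hy0 h.le (by linarith))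

/-- A barrier of order `|x|^{-(N-2s)}` with strictly negative fractional Laplacian far out. It is
`Γ + Γ^{1+κ}` for the smoothed fundamental solution `Γ`. For small `κ` the gain `|x|^{-N-κ(N-2s)}`
beats both `|x|^{-N-2s}` and the gradient term. -/
lemma exists_profile_rpow (hN : 0 < N) (hs : 0 < s) (hs1 : s < 1) (hNs : 2 * s < N)
    {β κ : ℝ} (hβ0 : 0 ≤ β) (hβ : β < N - 2 * s + 1) (hκ : 0 < κ) :
    ∃ (Φ : EuclideanSpace ℝ (Fin N) → ℝ) (M L c C c' : ℝ), IsProfile Φ β M L ∧ 0 < c ∧ 0 < C ∧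
      0 < c' ∧ (∀ x, 1 ≤ ‖x‖ → c * ‖x‖ ^ (-((N : ℝ) - 2 * s)) ≤ Φ x) ∧
      ∀ x, 2 ≤ ‖x‖ → HasFracUpper s Φ x (C * ‖x‖ ^ (-((N : ℝ) + 2 * s)) -
        c' * ‖x‖ ^ (-((N : ℝ) + κ * (N - 2 * s)))) := by
  set b := (N : ℝ) - 2 * s with hb
  have hb0 : 0 < b := by linarith
  set Γ : EuclideanSpace ℝ (Fin N) → ℝ := scaleAvg b bump with hΓ
  set B := 54 / b with hB
  have hB0 : 0 < B := by positivity
  have hsd : HasSecondDiffBound Γ B := hasSecondDiffBound_bump.scaleAvg hb0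
  have hΓ0 : ∀ x, 0 ≤ Γ x := scaleAvg_nonneg bump_nonneg
  have hΓB : ∀ x, Γ x ≤ B := fun x => (le_abs_self _).trans (hsd.abs_le x)
  have hlip : HasLipDecay Γ β (4 / (b + 1 - β)) :=
    (hasLipDecay_bump hβ0).scaleAvg hb0 hβ continuous_bump hasSecondDiffBound_bump.abs_le
  obtain ⟨C₀, hC₀, hdec⟩ := exists_symFracLap_scaleAvg_bump_decay (N := N) hN hs hs1 hNs
  have hlow : ∀ x : EuclideanSpace ℝ (Fin N), 1 ≤ ‖x‖ →
      2 ^ (-b) / (2 * b) * ‖x‖ ^ (-b) ≤ Γ x := fun x hx => le_scaleAvg_bump hb0 hx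
  obtain ⟨c', hc', hpow⟩ := exists_hasFracUpper_rpow hN hs hs1 hNs hκ
    (c := 2 ^ (-b) / (2 * b)) (C := 1 / b) (by positivity) (by positivity) hsd.continuous hΓ0 hΓB
    hlow (fun x hx => (scaleAvg_bump_le hb0 hx).trans (le_of_eq (by ring)))
  have htend : Tendsto Γ (Bornology.cobounded _) (𝓝 0) :=
    tendsto_of_abs_le_rpow (α := b / 2) (by positivity)
      (fun x hx => abs_scaleAvg_bump_le hx (by positivity) (by linarith))
  have hpos : 0 < b + 1 - β := by linarith
  have hcont : Continuous fun x => Γ x ^ (1 + κ) :=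
    hsd.continuous.rpow_const (fun _ => Or.inr (by linarith))
  have hpB : ∀ x, |Γ x ^ (1 + κ)| ≤ B ^ (1 + κ) := fun x => by
    rw [abs_of_nonneg (Real.rpow_nonneg (hΓ0 x) _)]
    exact Real.rpow_le_rpow (hΓ0 x) (hΓB x) (by linarith)
  refine ⟨fun x => Γ x + Γ x ^ (1 + κ), B + B ^ (1 + κ),
    4 / (b + 1 - β) + (1 + κ) * B ^ κ * (4 / (b + 1 - β)), 2 ^ (-b) / (2 * b),
    C₀ + (1 + κ) * B ^ κ * C₀, c', ⟨?_, ?_, ?_, ?_, ?_, ?_⟩, by positivity, by positivity, hc',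
    ?_, ?_⟩
  · exact hsd.continuous.add hcont
  · exact fun x => add_nonneg (hΓ0 x) (Real.rpow_nonneg (hΓ0 x) _)
  · exact fun x => add_le_add (hΓB x) ((le_abs_self _).trans (hpB x))
  · have h1 := htend.add (htend.rpow_const (p := 1 + κ) (Or.inr (by linarith)))
    rwa [Real.zero_rpow (by linarith), add_zero] at h1
  · positivity
  · exact hlip.add (hlip.rpow hκ hΓ0 hΓB)
  · intro x hx
    have := Real.rpow_nonneg (hΓ0 x) (1 + κ)
    linarith [hlow x hx]
  · intro x hx
    have h1 : HasFracUpper s Γ x (C₀ * ‖x‖ ^ (-((N : ℝ) + 2 * s))) :=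
      (hsd.hasFracUpper hN hs hs1 x).mono ((le_abs_self _).trans (hdec x hx))
    have h2 := hpow x _ (by linarith) h1
    refine (h1.add hN hs hs1 h2 hsd.continuous.aestronglyMeasurable hsd.abs_le
      hcont.aestronglyMeasurable hpB).mono ?_
    have h3 : Γ x ^ κ ≤ B ^ κ := Real.rpow_le_rpow (hΓ0 x) (hΓB x) hκ.le
    have h4 : (1 + κ) * Γ x ^ κ * (C₀ * ‖x‖ ^ (-((N : ℝ) + 2 * s))) ≤
        (1 + κ) * B ^ κ * (C₀ * ‖x‖ ^ (-((N : ℝ) + 2 * s))) := by gcongr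
    linarith

/-- A barrier of order `|x|^{-(N-2s)} log |x|` whose fractional Laplacian is at most `C |x|^{-N}`.
-/
lemma exists_profile_log (hN : 0 < N) (hs : 0 < s) (hs1 : s < 1) (hNs : 2 * s < N)
    {β : ℝ} (hβ0 : 0 ≤ β) (hβ : β < N - 2 * s + 1) :
    ∃ (Φ : EuclideanSpace ℝ (Fin N) → ℝ) (M L c C : ℝ), IsProfile Φ β M L ∧ 0 < c ∧ 0 < C ∧
      (∀ x, 1 ≤ ‖x‖ → c * ‖x‖ ^ (-((N : ℝ) - 2 * s)) * Real.log ‖x‖ ≤ Φ x) ∧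
      ∀ x, 2 ≤ ‖x‖ → HasFracUpper s Φ x (C * ‖x‖ ^ (-(N : ℝ))) := by
  set b := (N : ℝ) - 2 * s with hb
  have hb0 : 0 < b := by linarith
  set Γ : EuclideanSpace ℝ (Fin N) → ℝ := scaleAvg b bump with hΓ
  have hsd : HasSecondDiffBound Γ (54 / b) := hasSecondDiffBound_bump.scaleAvg hb0
  have hΓ0 : ∀ x, 0 ≤ Γ x := scaleAvg_nonneg bump_nonneg
  have hlip : HasLipDecay Γ β (4 / (b + 1 - β)) :=
    (hasLipDecay_bump hβ0).scaleAvg hb0 hβ continuous_bump hasSecondDiffBound_bump.abs_le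
  obtain ⟨C₀, hC₀, hdec⟩ := exists_symFracLap_scaleAvg_bump_decay (N := N) hN hs hs1 hNs
  have hsd2 : HasSecondDiffBound (scaleAvg b Γ) (54 / b / b) := hsd.scaleAvg hb0
  obtain ⟨C, hC, hle⟩ := exists_symFracLap_scaleAvg_le hN hs hs1 hNs hC₀.le hsd hdec
  have hpos : 0 < b + 1 - β := by linarith
  refine ⟨scaleAvg b Γ, 54 / b / b, 4 / (b + 1 - β) / (b + 1 - β), 2 ^ (-b) / (2 * b), C,
    ⟨hsd2.continuous, scaleAvg_nonneg hΓ0, fun x => (le_abs_self _).trans (hsd2.abs_le x), ?_,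
      by positivity, hlip.scaleAvg hb0 hβ hsd.continuous hsd.abs_le⟩, by positivity, hC, ?_, ?_⟩
  · exact tendsto_of_abs_le_rpow (α := b / 2) (by positivity)
      (fun x hx => abs_scaleAvg_le (by linarith)
        (fun y hy => abs_scaleAvg_bump_le hy (by positivity) (by linarith)) hx)
  · exact fun x hx => le_scaleAvg_log hb0 (by positivity) hsd.continuous hsd.abs_le hΓ0
      (fun y hy => le_scaleAvg_bump hb0 hy) hx
  · exact fun x hx => (hsd2.hasFracUpper hN hs hs1 x).mono (hle x hx)

/-! ### Touching from below and comparison -/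

lemma fracLaplacianConst_pos (hs : 0 < s) (hs1 : s < 1) : 0 < fracLaplacianConst N s := by
  unfold fracLaplacianConst
  have h1 : 0 < Real.Gamma ((N : ℝ) / 2 + s) := Real.Gamma_pos_of_pos (by positivity)
  have h2 : 0 < Real.Gamma (1 - s) := Real.Gamma_pos_of_pos (by linarith)
  have := Real.pi_pos
  positivity

lemma isOpen_norm_gt (R : ℝ) : IsOpen {x : EuclideanSpace ℝ (Fin N) | R < ‖x‖} :=
  isOpen_lt continuous_const continuous_norm

lemma MemWeightedL1.aestronglyMeasurable {u : EuclideanSpace ℝ (Fin N) → ℝ}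
    (hu : MemWeightedL1 s u) : AEStronglyMeasurable u := by
  have hm : AEStronglyMeasurable (fun x : EuclideanSpace ℝ (Fin N) => 1 + ‖x‖ ^ ((N : ℝ) + 2 * s))
      volume := Measurable.aestronglyMeasurable (by fun_prop)
  refine (hu.1.mul hm).congr (Eventually.of_forall fun x => ?_)
  have : (1 + ‖x‖ ^ ((N : ℝ) + 2 * s)) ≠ 0 := by positivity
  simp only [Pi.mul_apply]
  field_simp

lemma MemWeightedL1.integrableOn_trunc (hN : 0 < N) (hs : 0 < s) (hs1 : s < 1)
    {u : EuclideanSpace ℝ (Fin N) → ℝ}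
    (hu : MemWeightedL1 s u) (x : EuclideanSpace ℝ (Fin N)) {ε : ℝ} (hε : 0 < ε) :
    IntegrableOn (fun y => (u x - u y) / ‖x - y‖ ^ ((N : ℝ) + 2 * s)) (ball x ε)ᶜ := by
  set d := (N : ℝ) + 2 * s with hd
  have hd0 : 0 < d := by positivity
  have h1 := (integrableOn_kernel_compl_ball hN hs hs1 hε x).const_mul (u x)
  have h2 : IntegrableOn (fun y => u y / ‖x - y‖ ^ d) (ball x ε)ᶜ := by
    have hm : AEStronglyMeasurable (fun y => u y / ‖x - y‖ ^ d) (volume.restrict (ball x ε)ᶜ) :=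
      ((hu.aestronglyMeasurable).restrict.aemeasurable.div
        (Measurable.aemeasurable (by fun_prop))).aestronglyMeasurable
    refine ((hu.norm.const_mul ((ε ^ d)⁻¹ + (1 + ‖x‖ / ε) ^ d)).integrableOn).mono' hm ?_
    refine (ae_restrict_iff' measurableSet_ball.compl).2 (Eventually.of_forall fun y hy => ?_)
    have hy' : ε ≤ ‖x - y‖ := by
      simpa [mem_ball, dist_eq_norm, norm_sub_rev] using hy
    have hxy : 0 < ‖x - y‖ := hε.trans_le hy'
    have hy1 : ‖y‖ ≤ (1 + ‖x‖ / ε) * ‖x - y‖ := by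
      have h3 : ‖y‖ ≤ ‖x‖ + ‖x - y‖ := by
        have := norm_sub_le x (x - y); rwa [sub_sub_cancel] at this
      have h4 : ‖x‖ ≤ ‖x‖ / ε * ‖x - y‖ := by
        rw [div_mul_eq_mul_div, le_div_iff₀ hε]; gcongr
      linarith
    have h5 : ‖y‖ ^ d ≤ (1 + ‖x‖ / ε) ^ d * ‖x - y‖ ^ d := by
      rw [← Real.mul_rpow (by positivity) hxy.le]
      exact Real.rpow_le_rpow (norm_nonneg _) hy1 hd0.le
    have h6 : 1 ≤ (ε ^ d)⁻¹ * ‖x - y‖ ^ d := by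
      rw [inv_mul_eq_div, one_le_div (by positivity)]
      exact Real.rpow_le_rpow hε.le hy' hd0.le
    rw [norm_div, norm_div, Real.norm_of_nonneg (by positivity : 0 ≤ ‖x - y‖ ^ d),
      Real.norm_of_nonneg (by positivity : 0 ≤ 1 + ‖y‖ ^ d), ← mul_div_assoc,
      div_le_div_iff₀ (by positivity) (by positivity)]
    have h7 : 1 + ‖y‖ ^ d ≤ ((ε ^ d)⁻¹ + (1 + ‖x‖ / ε) ^ d) * ‖x - y‖ ^ d := by
      rw [add_mul]; linarith
    calc _ ≤ ‖u y‖ * (((ε ^ d)⁻¹ + (1 + ‖x‖ / ε) ^ d) * ‖x - y‖ ^ d) := by gcongr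
      _ = _ := by ring
  refine IntegrableOn.congr_fun (h1.sub h2) (fun y _ => ?_) measurableSet_ball.compl
  simp only [Pi.sub_apply]
  ring

/-- At a touching point from below, the gradient of `u` is at most the local Lipschitz constant of
the touching function: differentiate `u` in the direction `-∇u`. -/
lemma norm_gradient_le {u φ : EuclideanSpace ℝ (Fin N) → ℝ} {x : EuclideanSpace ℝ (Fin N)} {L : ℝ}
    (hu : DifferentiableAt ℝ u x) (hL : 0 ≤ L) (hmin : ∀ y, u x - φ x ≤ u y - φ y)
    (hlip : ∀ᶠ y in 𝓝 x, |φ y - φ x| ≤ L * ‖y - x‖) : ‖gradient u x‖ ≤ L := by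
  set g := gradient u x with hg
  rcases (norm_nonneg g).eq_or_lt with h0 | h0
  · rwa [← h0]
  have hgrad : HasFDerivAt u (fderiv ℝ u x) x := hu.hasFDerivAt
  have hgg : fderiv ℝ u x (-g) = -‖g‖ ^ 2 := by
    have h1 : HasGradientAt u g x := hu.hasGradientAt
    have h2 := h1.hasFDerivAt.fderiv
    rw [h2, map_neg, InnerProductSpace.toDual_apply_apply, real_inner_self_eq_norm_sq]
  have hd : HasDerivAt (fun t : ℝ => u (x + t • (-g))) (-‖g‖ ^ 2) 0 := by
    rw [← hgg]
    have h1 : HasDerivAt (fun t : ℝ => x + t • (-g)) (-g) 0 := by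
      simpa using ((hasDerivAt_id (0 : ℝ)).smul_const (-g)).const_add x
    have h2 : HasFDerivAt u (fderiv ℝ u x) (x + (0 : ℝ) • (-g)) := by simpa using hgrad
    exact h2.comp_hasDerivAt 0 h1
  have ht := hd.tendsto_slope_zero_right
  have hcont : Tendsto (fun t : ℝ => x + t • (-g)) (𝓝[>] 0) (𝓝 x) := by
    have : Continuous fun t : ℝ => x + t • (-g) := by fun_prop
    have h := this.tendsto 0
    rw [zero_smul, add_zero] at h
    exact h.mono_left nhdsWithin_le_nhds
  have hge : -(L * ‖g‖) ≤ -‖g‖ ^ 2 := by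
    refine ge_of_tendsto ht ?_
    filter_upwards [hcont.eventually hlip, self_mem_nhdsWithin] with t h1 h2
    have ht0 : 0 < t := h2
    have h3 := hmin (x + t • (-g))
    rw [add_sub_cancel_left, norm_smul, norm_neg, Real.norm_of_nonneg ht0.le] at h1
    have h4 := (abs_le.1 h1).1
    rw [zero_add, zero_smul, add_zero, smul_eq_mul, inv_mul_eq_div, le_div_iff₀ ht0]
    linarith
  nlinarith

/-- The supersolution inequality tested with a function `φ` touching `u` from below (up to a
constant) at `x`. -/
lemma IsClassicalSupersolution.le_of_touching (hN : 0 < N) (hs : 0 < s) (hs1 : s < 1)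
    {q lam R₀ : ℝ} {f : ℝ → ℝ} {u φ : EuclideanSpace ℝ (Fin N) → ℝ}
    (hu : IsClassicalSupersolution s q lam R₀ f u) (hq : 0 ≤ q)
    {B l L : ℝ} {x : EuclideanSpace ℝ (Fin N)} (hx : R₀ < ‖x‖)
    (hφm : AEStronglyMeasurable φ) (hφB : ∀ x, |φ x| ≤ B)
    (hmin : ∀ y, u x - φ x ≤ u y - φ y) (hup : HasFracUpper s φ x l) (hL : 0 ≤ L)
    (hlip : ∀ᶠ y in 𝓝 x, |φ y - φ x| ≤ L * ‖y - x‖) :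
    lam * f (u x) ≤ fracLaplacianConst N s * l + L ^ q := by
  obtain ⟨l₀, hl₀, hineq⟩ := hu.inequality x hx
  have hC := fracLaplacianConst_pos (N := N) hs hs1
  have h1 : l₀ ≤ fracLaplacianConst N s * l := by
    refine le_of_forall_pos_le_add fun δ hδ => ?_
    refine le_of_tendsto hl₀ ?_
    filter_upwards [hup (δ / fracLaplacianConst N s) (by positivity), self_mem_nhdsWithin]
      with ε hε hε0
    have h2 : ∫ y in (ball x ε)ᶜ, (u x - u y) / ‖x - y‖ ^ ((N : ℝ) + 2 * s) ≤
        truncFracLap s φ x ε := by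
      refine setIntegral_mono (hu.memWeightedL1.integrableOn_trunc hN hs hs1 x hε0)
        (integrableOn_trunc hN hs hs1 hε0 hφm hφB x) fun y => ?_
      refine div_le_div_of_nonneg_right ?_ (by positivity)
      linarith [hmin y]
    calc _ ≤ fracLaplacianConst N s * (l + δ / fracLaplacianConst N s) := by
          gcongr; exact h2.trans hε
      _ = _ := by field_simp
  have hd : DifferentiableAt ℝ u x :=
    (hu.contDiffOn.contDiffAt ((isOpen_norm_gt R₀).mem_nhds hx)).differentiableAt (by norm_num)
  have h2 : ‖gradient u x‖ ^ q ≤ L ^ q :=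
    Real.rpow_le_rpow (norm_nonneg _) (norm_gradient_le hd hL hmin hlip) hq
  linarith

/-- If `φ` vanishes at infinity and lies below `u` in the ball of radius `R₁` but not everywhere,
then `u - φ` attains its (negative) minimum outside that ball. -/
lemma exists_touching_point {u φ : EuclideanSpace ℝ (Fin N) → ℝ} {R₀ R₁ : ℝ} (hR : R₀ < R₁)
    (hu0 : ∀ x, 0 < u x) (hu : ContinuousOn u {x | R₀ < ‖x‖})
    (hφ : ContinuousOn φ {x | R₀ < ‖x‖}) (hφ0 : Tendsto φ (Bornology.cobounded _) (𝓝 0))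
    (hhole : ∀ x, ‖x‖ ≤ R₁ → φ x ≤ u x) {x₁ : EuclideanSpace ℝ (Fin N)} (hx₁ : u x₁ < φ x₁) :
    ∃ x, R₁ < ‖x‖ ∧ u x < φ x ∧ ∀ y, u x - φ x ≤ u y - φ y := by
  have hev : ∀ᶠ x in Bornology.cobounded (EuclideanSpace ℝ (Fin N)), φ x < φ x₁ - u x₁ :=
    hφ0.eventually (gt_mem_nhds (by linarith))
  rw [← comap_norm_atTop, eventually_comap] at hev
  obtain ⟨R₂, hR₂⟩ := eventually_atTop.1 hev
  have hx₁R : R₁ < ‖x₁‖ := by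
    by_contra h
    linarith [hhole x₁ (not_lt.1 h)]
  set K := closedBall (0 : EuclideanSpace ℝ (Fin N)) (max R₂ ‖x₁‖) ∩ {x | R₁ ≤ ‖x‖} with hK
  have hKc : IsCompact K := (isCompact_closedBall _ _).inter_right
    (isClosed_le continuous_const continuous_norm)
  have hsub : K ⊆ {x | R₀ < ‖x‖} := fun x hx => hR.trans_le hx.2
  have hx₁K : x₁ ∈ K := ⟨by simp, hx₁R.le⟩
  obtain ⟨x, hxK, hx⟩ := hKc.exists_isMinOn ⟨x₁, hx₁K⟩ ((hu.mono hsub).sub (hφ.mono hsub))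
  have hx1 : u x - φ x ≤ u x₁ - φ x₁ := hx hx₁K
  refine ⟨x, ?_, by linarith, fun y => ?_⟩
  · by_contra h
    linarith [hhole x (not_lt.1 h)]
  · rcases lt_or_ge ‖y‖ R₁ with h1 | h1
    · linarith [hhole y h1.le]
    · rcases le_or_gt ‖y‖ (max R₂ ‖x₁‖) with h2 | h2
      · exact hx (show y ∈ K from ⟨by simpa using h2, h1⟩)
      · have := hR₂ ‖y‖ ((le_max_left _ _).trans h2.le) y rfl
        linarith [hu0 y]

/-- Comparison with a barrier: if `a Φ ≤ u` in the shell `R < |x| ≤ R₁`, and `a Φ`, cut off in the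
hole, is a strict subsolution at those points outside where it exceeds `u`, then `a Φ ≤ u` for
`|x| > R`. -/
lemma IsClassicalSupersolution.profile_le (hN : 0 < N) (hs : 0 < s) (hs1 : s < 1)
    {q lam R₀ : ℝ} {f : ℝ → ℝ} {u Φ : EuclideanSpace ℝ (Fin N) → ℝ}
    (hu : IsClassicalSupersolution s q lam R₀ f u) (hu0 : ∀ x, 0 < u x) (hq : 0 ≤ q)
    {β M L R R₁ a C : ℝ} (hΦ : IsProfile Φ β M L) (hβ : 0 ≤ β) (hR : R₀ < R) (hR0 : 0 < R)
    (hR₁ : 2 * R ≤ R₁)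
    (hind : ∀ x l, 2 * R ≤ ‖x‖ → HasFracUpper s Φ x l →
      HasFracUpper s ({y | R < ‖y‖}.indicator Φ) x (l + C * ‖x‖ ^ (-((N : ℝ) + 2 * s))))
    (ha : 0 < a) (hhole : ∀ x, R < ‖x‖ → ‖x‖ ≤ R₁ → a * Φ x ≤ u x)
    (l : EuclideanSpace ℝ (Fin N) → ℝ)
    (hl : ∀ x, R₁ < ‖x‖ → HasFracUpper s Φ x (l x))
    (hstrict : ∀ x, R₁ < ‖x‖ → u x < a * Φ x →
      fracLaplacianConst N s * (a * (l x + C * ‖x‖ ^ (-((N : ℝ) + 2 * s)))) +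
        (a * (L * 2 ^ β * ‖x‖ ^ (-β))) ^ q < lam * f (u x)) :
    ∀ x, R < ‖x‖ → a * Φ x ≤ u x := by
  by_contra! hcon
  obtain ⟨x₁, hx₁, hlt⟩ := hcon
  set A : Set (EuclideanSpace ℝ (Fin N)) := {y | R < ‖y‖} with hA
  have hAo : IsOpen A := isOpen_norm_gt R
  set φ : EuclideanSpace ℝ (Fin N) → ℝ := fun y => a * A.indicator Φ y with hφ
  have hφA : ∀ y ∈ A, φ y = a * Φ y := fun y hy => by simp only [hφ]; rw [indicator_of_mem hy]
  have hindle : ∀ y, 0 ≤ A.indicator Φ y ∧ A.indicator Φ y ≤ Φ y := fun y =>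
    ⟨indicator_nonneg (fun y _ => hΦ.nonneg y) y, indicator_le_self' (fun y _ => hΦ.nonneg y) y⟩
  have htend : Tendsto φ (Bornology.cobounded _) (𝓝 0) := by
    have := hΦ.tendsto.const_mul a
    rw [mul_zero] at this
    exact squeeze_zero (fun y => mul_nonneg ha.le (hindle y).1)
      (fun y => mul_le_mul_of_nonneg_left (hindle y).2 ha.le) this
  have hcont : ContinuousOn φ {x | R < ‖x‖} :=
    (continuous_const.mul hΦ.continuous).continuousOn.congr hφA
  obtain ⟨x, hxR, hxlt, hmin⟩ := exists_touching_point (R₀ := R) (R₁ := R₁) (by linarith) hu0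
    (hu.contDiffOn.continuousOn.mono fun y hy => hR.trans hy) hcont htend
    (fun y hy => by
      by_cases h : R < ‖y‖
      · rw [hφA y h]; exact hhole y h hy
      · simp only [hφ]
        rw [indicator_of_notMem (show y ∉ A from h), mul_zero]; exact (hu0 y).le)
    (x₁ := x₁) (by rw [hφA x₁ hx₁]; exact hlt)
  have hxA : x ∈ A := show R < ‖x‖ by linarith
  have hx0 : 0 < ‖x‖ := by linarith
  have hM0 : 0 ≤ M := (hΦ.nonneg 0).trans (hΦ.le 0)
  have key := hu.le_of_touching (φ := φ) (B := a * M) (L := a * (L * 2 ^ β * ‖x‖ ^ (-β)))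
    hN hs hs1 hq (by linarith)
    (Measurable.aestronglyMeasurable
      ((hΦ.continuous.measurable.indicator hAo.measurableSet).const_mul a))
    (fun y => by
      rw [abs_of_nonneg (mul_nonneg ha.le (hindle y).1)]
      exact mul_le_mul_of_nonneg_left ((hindle y).2.trans (hΦ.le y)) ha.le)
    hmin ((hind x _ (by linarith) (hl x hxR)).const_mul ha)
    (by have := hΦ.lip_nonneg; positivity) ?_
  · rw [hφA x hxA] at hxlt
    exact absurd key (not_le.2 (hstrict x hxR hxlt))
  · filter_upwards [hAo.mem_nhds hxA, ball_mem_nhds x (show 0 < ‖x‖ / 2 by positivity)]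
      with y hy hyb
    have hyb : ‖y - x‖ < ‖x‖ / 2 := by simpa [dist_eq_norm] using hyb
    have hyn : ‖x‖ / 2 ≤ ‖y‖ := by
      have := norm_sub_norm_le x y; rw [norm_sub_rev] at this; linarith
    have hy0 : 0 < ‖y‖ := by linarith
    rw [hφA x hxA, hφA y hy, ← mul_sub, abs_mul, abs_of_pos ha]
    have h1 := hΦ.lip y x (norm_pos_iff.1 hy0) (norm_pos_iff.1 hx0)
    have h2 : min ‖y‖ ‖x‖ ^ (-β) ≤ 2 ^ β * ‖x‖ ^ (-β) := by
      calc _ ≤ (‖x‖ / 2) ^ (-β) :=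
            Real.rpow_le_rpow_of_nonpos (by positivity) (le_min hyn (by linarith)) (by linarith)
        _ = _ := by
          rw [Real.div_rpow hx0.le zero_le_two, Real.rpow_neg zero_le_two, div_inv_eq_mul, mul_comm]
    have hL := hΦ.lip_nonneg
    calc _ ≤ a * (L * min ‖y‖ ‖x‖ ^ (-β) * ‖y - x‖) := by gcongr
      _ ≤ a * (L * (2 ^ β * ‖x‖ ^ (-β)) * ‖y - x‖) := by gcongr
      _ = _ := by ring

/-! ### Lower bounds for supersolutions -/

lemma exists_pos_le_of_annulus {u : EuclideanSpace ℝ (Fin N) → ℝ} {R₀ : ℝ} (hu0 : ∀ x, 0 < u x)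
    (hu : ContinuousOn u {x | R₀ < ‖x‖}) {R : ℝ} (hR : R₀ < R) (R₁ : ℝ) :
    ∃ δ > 0, ∀ x, R ≤ ‖x‖ → ‖x‖ ≤ R₁ → δ ≤ u x := by
  set K := closedBall (0 : EuclideanSpace ℝ (Fin N)) R₁ ∩ {x | R ≤ ‖x‖} with hK
  have hKc : IsCompact K := (isCompact_closedBall _ _).inter_right
    (isClosed_le continuous_const continuous_norm)
  rcases K.eq_empty_or_nonempty with h | h
  · refine ⟨1, one_pos, fun x h1 h2 => ?_⟩
    have : x ∈ K := ⟨by simpa using h2, h1⟩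
    rw [h] at this
    exact this.elim
  · obtain ⟨x, _, hx⟩ := hKc.exists_isMinOn h (hu.mono fun x hx => hR.trans_le hx.2)
    exact ⟨u x, hu0 x, fun y h1 h2 => hx (show y ∈ K from ⟨by simpa using h2, h1⟩)⟩

lemma exists_rpow_le_of_liminf {f : ℝ → ℝ} {p : ℝ}
    (h : 0 < liminf (fun t : ℝ => ((f t / t ^ p : ℝ) : EReal)) (𝓝[>] (0 : ℝ))) :
    ∃ c > 0, ∃ t₀ > 0, ∀ t, 0 < t → t ≤ t₀ → c * t ^ p ≤ f t := by
  obtain ⟨c, hc0, hc⟩ := EReal.lt_iff_exists_real_btwn.1 h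
  have hev := eventually_lt_of_lt_liminf hc
  rw [eventually_nhdsWithin_iff, Metric.eventually_nhds_iff] at hev
  obtain ⟨e, he, hev⟩ := hev
  refine ⟨c, by exact_mod_cast hc0, e / 2, by positivity, fun t ht hte => ?_⟩
  have h1 := hev (y := t) (by rw [Real.dist_eq, sub_zero, abs_of_pos ht]; linarith) ht
  have h2 : c < f t / t ^ p := by exact_mod_cast h1
  rw [lt_div_iff₀ (by positivity)] at h2
  exact h2.le

/-- The assumption `q > N / (N + 1 - 2s)` leaves room for a gradient decay exponent `β < N - 2s +
1` with `β q > N`. -/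
lemma exists_beta {b q n : ℝ} (hn : 0 < n) (hq0 : 0 < q) (hq : n < q * (b + 1)) :
    ∃ β, 0 ≤ β ∧ β < b + 1 ∧ n < β * q := by
  have h1 : n / q < b + 1 := by rw [div_lt_iff₀ hq0]; linarith
  obtain ⟨β, h2, h3⟩ := exists_between h1
  refine ⟨β, le_trans (by positivity) h2.le, h3, ?_⟩
  rwa [div_lt_iff₀ hq0] at h2

lemma mul_rpow_le_of_le_one {a q K r β : ℝ} (ha : 0 < a) (ha1 : a ≤ 1) (hq : 1 ≤ q) (hK : 0 ≤ K)
    (hr : 0 < r) : (a * (K * r ^ (-β))) ^ q ≤ a * (K ^ q * r ^ (-(β * q))) := by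
  rw [Real.mul_rpow ha.le (by positivity), Real.mul_rpow hK (by positivity), ← Real.rpow_mul hr.le,
    neg_mul]
  gcongr
  exact Real.rpow_le_self_of_le_one ha.le ha1 hq

/-- A positive supersolution decays at most as fast as the fundamental solution. -/
lemma IsClassicalSupersolution.exists_rpow_le (hN : 0 < N) (hs : 0 < s) (hs1 : s < 1)
    (hNs : 2 * s < N) {q lam R₀ : ℝ} {f : ℝ → ℝ} {u : EuclideanSpace ℝ (Fin N) → ℝ}
    (hu : IsClassicalSupersolution s q lam R₀ f u) (hu0 : ∀ x, 0 < u x) (hR₀ : 0 < R₀)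
    (hlam : 0 < lam) (hf : ∀ t, 0 < t → 0 < f t)
    (hq1 : 1 ≤ q) (hq : (N : ℝ) < q * (N - 2 * s + 1)) :
    ∃ c > 0, ∀ x, R₀ + 1 < ‖x‖ → c * ‖x‖ ^ (-((N : ℝ) - 2 * s)) ≤ u x := by
  set b := (N : ℝ) - 2 * s with hb
  have hb0 : 0 < b := by linarith
  have hN' : (0 : ℝ) < N := by exact_mod_cast hN
  obtain ⟨β, hβ0, hβ, hβq⟩ := exists_beta hN' (by linarith) hq
  obtain ⟨e, he0, he⟩ := exists_between (show 0 < min (2 * s) (β * q - N) from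
    lt_min (by linarith) (by linarith))
  obtain ⟨he1, he2⟩ := lt_min_iff.1 he
  have hκb : e / b * b = e := by field_simp
  obtain ⟨Φ, M, L, c, C, c', hΦ, hc, hC, hc', hlow, hup⟩ :=
    exists_profile_rpow (κ := e / b) hN hs hs1 hNs hβ0 hβ (by positivity)
  rw [← hb, hκb] at hup
  obtain ⟨Ci, hCi, hind⟩ := exists_hasFracUpper_indicator hN hs hs1 hΦ.continuous hΦ.nonneg hΦ.le
    (show 0 < R₀ + 1 by linarith)
  set Cn := fracLaplacianConst N s with hCn
  have hCn0 : 0 < Cn := fracLaplacianConst_pos hs hs1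
  have hL := hΦ.lip_nonneg
  set K := L * 2 ^ β with hK
  have hK0 : 0 ≤ K := by positivity
  obtain ⟨R₁, hR₁, hev⟩ : ∃ R₁, max (2 * (R₀ + 1)) 2 ≤ R₁ ∧ ∀ r, R₁ ≤ r →
      Cn * (C + Ci) * r ^ (-(2 * s - e)) + K ^ q * r ^ (-(β * q - N - e)) < Cn * c' := by
    have h1 : Tendsto (fun r : ℝ => Cn * (C + Ci) * r ^ (-(2 * s - e)) +
        K ^ q * r ^ (-(β * q - N - e))) atTop (𝓝 0) := by
      have := ((tendsto_rpow_neg_atTop (y := 2 * s - e) (by linarith)).const_mul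
        (Cn * (C + Ci))).add
        ((tendsto_rpow_neg_atTop (y := β * q - N - e) (by linarith)).const_mul (K ^ q))
      simpa using this
    obtain ⟨R₁, h⟩ := eventually_atTop.1 ((h1.eventually
      (gt_mem_nhds (show 0 < Cn * c' by positivity))).and
      (eventually_ge_atTop (max (2 * (R₀ + 1)) 2)))
    exact ⟨R₁, (h R₁ le_rfl).2, fun r hr => (h r hr).1⟩
  obtain ⟨hR₁a, hR₁b⟩ := max_le_iff.1 hR₁
  obtain ⟨δ, hδ, hδu⟩ := exists_pos_le_of_annulus hu0 hu.contDiffOn.continuousOn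
    (show R₀ < R₀ + 1 by linarith) R₁
  have hM0 : 0 ≤ M := (hΦ.nonneg 0).trans (hΦ.le 0)
  -- `a M ≤ δ` puts `a Φ` below `u` on the shell, and `a ≤ 1` gives `a ^ q ≤ a`
  set a := min 1 (δ / (M + 1)) with ha
  have ha0 : 0 < a := lt_min one_pos (by positivity)
  have ha1 : a ≤ 1 := min_le_left _ _
  have haM : a * M ≤ δ := by
    have : a * (M + 1) ≤ δ := (le_div_iff₀ (by positivity)).1 (min_le_right 1 (δ / (M + 1)))
    nlinarith
  refine ⟨a * c, by positivity, fun x hx => ?_⟩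
  have hmain := hu.profile_le hN hs hs1 hu0 (by linarith) hΦ hβ0 (R := R₀ + 1) (R₁ := R₁) (C := Ci)
    (by linarith) (by linarith) hR₁a hind ha0
    (fun y h1 h2 => le_trans (by gcongr; exact hΦ.le y) (haM.trans (hδu y h1.le h2)))
    _ (fun y hy => hup y (by linarith)) (fun y hy _ => ?_) x hx
  · have h1 := hlow x (by linarith)
    calc _ = a * (c * ‖x‖ ^ (-b)) := by ring
      _ ≤ a * Φ x := by gcongr
      _ ≤ u x := hmain
  · have hr0 : 0 < ‖y‖ := by linarith
    have hpos : 0 < lam * f (u y) := mul_pos hlam (hf _ (hu0 y))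
    refine lt_trans ?_ hpos
    have h1 := mul_rpow_le_of_le_one (β := β) ha0 ha1 hq1 hK0 hr0
    have h2 := hev ‖y‖ hy.le
    have h3 : ‖y‖ ^ (-((N : ℝ) + 2 * s)) = ‖y‖ ^ (-(2 * s - e)) * ‖y‖ ^ (-((N : ℝ) + e)) := by
      rw [← Real.rpow_add hr0]; congr 1; ring
    have h4 : ‖y‖ ^ (-(β * q)) = ‖y‖ ^ (-(β * q - N - e)) * ‖y‖ ^ (-((N : ℝ) + e)) := by
      rw [← Real.rpow_add hr0]; congr 1; ring
    have hX : 0 < ‖y‖ ^ (-((N : ℝ) + e)) := by positivity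
    rw [h4] at h1
    rw [h3]
    generalize ‖y‖ ^ (-((N : ℝ) + e)) = X at *
    generalize ‖y‖ ^ (-(2 * s - e)) = Y at *
    generalize ‖y‖ ^ (-(β * q - N - e)) = Z at *
    have h5 : a * X * (Cn * (C + Ci) * Y + K ^ q * Z - Cn * c') < 0 :=
      mul_neg_of_pos_of_neg (by positivity) (by linarith)
    linarith

/-- The bound `u ≥ c |x|^{-(N-2s)}` makes the source at least `c |x|^{-N}`, since `p (N - 2s) =
N`, and this improves the lower bound by a logarithm. -/
lemma IsClassicalSupersolution.exists_log_le (hN : 0 < N) (hs : 0 < s) (hs1 : s < 1)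
    (hNs : 2 * s < N) {q p lam R₀ : ℝ} {f : ℝ → ℝ} {u : EuclideanSpace ℝ (Fin N) → ℝ}
    (hu : IsClassicalSupersolution s q lam R₀ f u) (hu0 : ∀ x, 0 < u x) (hR₀ : 0 < R₀)
    (hlam : 0 < lam) (hmono : MonotoneOn f (Ioi 0)) (hp : p = N / (N - 2 * s))
    {c₀ t₀ : ℝ} (hc₀ : 0 < c₀) (ht₀ : 0 < t₀) (hf : ∀ t, 0 < t → t ≤ t₀ → c₀ * t ^ p ≤ f t)
    (hq1 : 1 ≤ q) (hq : (N : ℝ) < q * (N - 2 * s + 1)) :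
    ∃ c > 0, ∀ x, R₀ + 1 < ‖x‖ →
      c * ‖x‖ ^ (-((N : ℝ) - 2 * s)) * Real.log ‖x‖ ≤ u x := by
  have hfpos : ∀ t, 0 < t → 0 < f t := fun t ht => by
    have h1 : 0 < min t t₀ := lt_min ht ht₀
    have h2 := hf _ h1 (min_le_right _ _)
    have h3 := hmono h1 ht (min_le_left _ _)
    have : 0 < c₀ * min t t₀ ^ p := by positivity
    linarith
  obtain ⟨c₁, hc₁, hc₁u⟩ := hu.exists_rpow_le hN hs hs1 hNs hu0 hR₀ hlam hfpos hq1 hq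
  set b := (N : ℝ) - 2 * s with hb
  have hb0 : 0 < b := by linarith
  have hN' : (0 : ℝ) < N := by exact_mod_cast hN
  have hbp : b * p = N := by rw [hp]; field_simp
  obtain ⟨β, hβ0, hβ, hβq⟩ := exists_beta hN' (by linarith) hq
  obtain ⟨Φ, M, L, c, C, hΦ, hc, hC, hlow, hup⟩ := exists_profile_log hN hs hs1 hNs hβ0 hβ
  obtain ⟨Ci, hCi, hind⟩ := exists_hasFracUpper_indicator hN hs hs1 hΦ.continuous hΦ.nonneg hΦ.le
    (show 0 < R₀ + 1 by linarith)
  set Cn := fracLaplacianConst N s with hCn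
  have hCn0 : 0 < Cn := fracLaplacianConst_pos hs hs1
  have hL := hΦ.lip_nonneg
  set K := L * 2 ^ β with hK
  have hK0 : 0 ≤ K := by positivity
  obtain ⟨R₁, hR₁, hev⟩ : ∃ R₁, max (2 * (R₀ + 1)) 2 ≤ R₁ ∧ ∀ r, R₁ ≤ r → c₁ * r ^ (-b) ≤ t₀ := by
    have h1 : Tendsto (fun r : ℝ => c₁ * r ^ (-b)) atTop (𝓝 0) := by
      simpa using (tendsto_rpow_neg_atTop hb0).const_mul c₁
    obtain ⟨R₁, h⟩ := eventually_atTop.1 ((h1.eventually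
      (ge_mem_nhds ht₀)).and (eventually_ge_atTop (max (2 * (R₀ + 1)) 2)))
    exact ⟨R₁, (h R₁ le_rfl).2, fun r hr => (h r hr).1⟩
  obtain ⟨hR₁a, hR₁b⟩ := max_le_iff.1 hR₁
  obtain ⟨δ, hδ, hδu⟩ := exists_pos_le_of_annulus hu0 hu.contDiffOn.continuousOn
    (show R₀ < R₀ + 1 by linarith) R₁
  have hM0 : 0 ≤ M := (hΦ.nonneg 0).trans (hΦ.le 0)
  set D := Cn * (C + Ci) + K ^ q with hD
  have hD0 : 0 < D := by positivity
  set σ := lam * (c₀ * c₁ ^ p) with hσ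
  have hσ0 : 0 < σ := by positivity
  -- the third entry lets the source `σ |x|^{-N}` dominate the terms `a D |x|^{-N}` of the barrier
  set a := min 1 (min (δ / (M + 1)) (σ / (2 * D))) with ha
  have ha0 : 0 < a := lt_min one_pos (lt_min (by positivity) (by positivity))
  have ha1 : a ≤ 1 := min_le_left _ _
  have haM : a * M ≤ δ := by
    have : a * (M + 1) ≤ δ := (le_div_iff₀ (by positivity)).1
      ((min_le_right 1 _).trans (min_le_left _ _))
    nlinarith
  have haD : a * D < σ := by
    have : a * (2 * D) ≤ σ := (le_div_iff₀ (by positivity)).1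
      ((min_le_right 1 _).trans (min_le_right _ _))
    have : 0 < a * D := by positivity
    linarith
  refine ⟨a * c, by positivity, fun x hx => ?_⟩
  have hmain := hu.profile_le hN hs hs1 hu0 (by linarith) hΦ hβ0 (R := R₀ + 1) (R₁ := R₁) (C := Ci)
    (by linarith) (by linarith) hR₁a hind ha0
    (fun y h1 h2 => le_trans (by gcongr; exact hΦ.le y) (haM.trans (hδu y h1.le h2)))
    _ (fun y hy => hup y (by linarith)) (fun y hy _ => ?_) x hx
  · have h1 := hlow x (by linarith)
    calc _ = a * (c * ‖x‖ ^ (-b) * Real.log ‖x‖) := by ring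
      _ ≤ a * Φ x := by gcongr
      _ ≤ u x := hmain
  · have hr0 : 0 < ‖y‖ := by linarith
    have hr1 : 1 ≤ ‖y‖ := by linarith
    have hX : 0 < ‖y‖ ^ (-(N : ℝ)) := by positivity
    have h1 := mul_rpow_le_of_le_one (β := β) ha0 ha1 hq1 hK0 hr0
    have h3 : ‖y‖ ^ (-((N : ℝ) + 2 * s)) ≤ ‖y‖ ^ (-(N : ℝ)) :=
      Real.rpow_le_rpow_of_exponent_le hr1 (by linarith)
    have h4 : ‖y‖ ^ (-(β * q)) ≤ ‖y‖ ^ (-(N : ℝ)) :=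
      Real.rpow_le_rpow_of_exponent_le hr1 (by linarith)
    have h5 : c₀ * c₁ ^ p * ‖y‖ ^ (-(N : ℝ)) ≤ f (u y) := by
      have h6 : 0 < c₁ * ‖y‖ ^ (-b) := by positivity
      have h7 := hf _ h6 (hev ‖y‖ hy.le)
      have h8 := hmono h6 (hu0 y) (hc₁u y (by linarith))
      rw [Real.mul_rpow hc₁.le (by positivity), ← Real.rpow_mul hr0.le, neg_mul, hbp,
        ← mul_assoc] at h7
      exact h7.trans h8
    calc _ ≤ Cn * (a * (C * ‖y‖ ^ (-(N : ℝ)) + Ci * ‖y‖ ^ (-(N : ℝ)))) +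
          a * (K ^ q * ‖y‖ ^ (-(N : ℝ))) := by
          refine add_le_add ?_ (h1.trans ?_) <;> gcongr
      _ = a * D * ‖y‖ ^ (-(N : ℝ)) := by rw [hD]; ring
      _ < σ * ‖y‖ ^ (-(N : ℝ)) := by gcongr
      _ = lam * (c₀ * c₁ ^ p * ‖y‖ ^ (-(N : ℝ))) := by rw [hσ]; ring
      _ ≤ _ := by gcongr

/-! ### Touching bumps and the contradiction -/

lemma secondDiff_translate (φ : EuclideanSpace ℝ (Fin N) → ℝ) (K : ℝ)
    (z x y : EuclideanSpace ℝ (Fin N)) :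
    secondDiff (fun w => K * φ (w - z)) x y = K * secondDiff φ (x - z) y := by
  simp only [secondDiff]
  rw [show x + y - z = x - z + y by abel, show x - y - z = x - z - y by abel]
  ring

lemma HasSecondDiffBound.translate {φ : EuclideanSpace ℝ (Fin N) → ℝ} {B : ℝ}
    (h : HasSecondDiffBound φ B) {K : ℝ} (hK : 0 ≤ K) (z : EuclideanSpace ℝ (Fin N)) :
    HasSecondDiffBound (fun w => K * φ (w - z)) (K * B) := by
  have := h.continuous
  refine ⟨by fun_prop, fun x => ?_, fun x y => ?_⟩
  · rw [abs_mul, abs_of_nonneg hK]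
    gcongr
    exact h.abs_le _
  · rw [secondDiff_translate, abs_mul, abs_of_nonneg hK, mul_assoc]
    gcongr
    exact h.secondDiff_le _ _

lemma symFracLap_translate (φ : EuclideanSpace ℝ (Fin N) → ℝ) (K : ℝ)
    (z x : EuclideanSpace ℝ (Fin N)) :
    symFracLap s (fun w => K * φ (w - z)) x = K * symFracLap s φ (x - z) := by
  unfold symFracLap
  simp only [secondDiff_translate, mul_div_assoc]
  rw [integral_const_mul]
  ring

/-- Touching `u` from below by a bump of height `2 u(z)` at the scale `|z| / 2` around `z`. -/
lemma IsClassicalSupersolution.exists_touching_bump (hN : 0 < N) (hs : 0 < s) (hs1 : s < 1)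
    {q lam R₀ : ℝ} {f : ℝ → ℝ} {u : EuclideanSpace ℝ (Fin N) → ℝ}
    (hu : IsClassicalSupersolution s q lam R₀ f u) (hu0 : ∀ x, 0 < u x) (hR₀ : 0 < R₀)
    (hq : 0 ≤ q) :
    ∃ C > 0, ∀ z, 2 * (R₀ + 1) < ‖z‖ → ∃ x, ‖x - z‖ < ‖z‖ / 2 ∧ u x ≤ u z ∧
      lam * f (u x) ≤ C * (u z * ‖z‖ ^ (-(2 * s)) + (u z * ‖z‖⁻¹) ^ q) := by
  obtain ⟨G, hGb⟩ : ∃ G, ∀ x : EuclideanSpace ℝ (Fin N), |symFracLap s bump x| ≤ G :=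
    ⟨_, hasSecondDiffBound_bump.abs_symFracLap_le hN hs hs1⟩
  have hG0 : 0 ≤ G := (abs_nonneg _).trans (hGb 0)
  set Cn := fracLaplacianConst N s with hCn
  have hCn0 : 0 < Cn := fracLaplacianConst_pos hs hs1
  refine ⟨Cn * 2 * 2 ^ (2 * s) * G + 16 ^ q, by positivity, fun z hz => ?_⟩
  set r := ‖z‖ / 2 with hr
  have hr1 : 1 < r := by linarith
  have hr0 : 0 < r := by linarith
  have huz := hu0 z
  set φ : EuclideanSpace ℝ (Fin N) → ℝ := fun y => 2 * u z * bump (r⁻¹ • (y - z)) with hφ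
  have hφz : φ z = 2 * u z := by simp [hφ, bump_zero]
  have hφ0 : ∀ y, r ≤ ‖y - z‖ → φ y = 0 := by
    intro y hy
    simp only [hφ]
    rw [bump_eq_zero, mul_zero]
    rw [norm_inv_smul hr0, one_le_div hr0]
    exact hy
  have hsd : HasSecondDiffBound φ (2 * u z * 54) :=
    (hasSecondDiffBound_bump.comp_smul hr1).translate (by positivity) z
  have htend : Tendsto φ (Bornology.cobounded _) (𝓝 0) := by
    refine tendsto_const_nhds.congr' ?_
    filter_upwards [(tendsto_norm_cobounded_atTop (E := EuclideanSpace ℝ (Fin N))).eventually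
      (eventually_ge_atTop (r + ‖z‖))] with y hy
    rw [hφ0 y (by have := norm_sub_norm_le y z; linarith)]
  obtain ⟨x, hxr, hxφ, hmin⟩ := exists_touching_point (R₀ := R₀) (R₁ := r) (by linarith) hu0
    hu.contDiffOn.continuousOn hsd.continuous.continuousOn htend
    (fun y hy => by
      rw [hφ0 y (by have := norm_sub_norm_le z y; rw [norm_sub_rev] at this; linarith)]
      exact (hu0 y).le)
    (x₁ := z) (by rw [hφz]; linarith)
  have hux := hu0 x
  have hφle : φ x ≤ 2 * u z := by
    simp only [hφ]
    exact mul_le_of_le_one_right (by positivity) (bump_le_one _)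
  refine ⟨x, ?_, ?_, ?_⟩
  · by_contra h
    rw [hφ0 x (not_lt.1 h)] at hxφ
    linarith
  · have := hmin z
    linarith
  · have key := hu.le_of_touching (φ := φ) (L := 2 * u z * (4 * r⁻¹)) hN hs hs1 hq (by linarith)
      hsd.continuous.aestronglyMeasurable hsd.abs_le hmin (hsd.hasFracUpper hN hs hs1 x)
      (by positivity) (Eventually.of_forall fun y => ?_)
    · have e1 : symFracLap s φ x ≤ 2 * u z * (r ^ (-(2 * s)) * G) := by
        have h1 := symFracLap_translate (s := s) (fun w => bump (r⁻¹ • w)) (2 * u z) z x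
        rw [symFracLap_comp_smul bump hr0] at h1
        rw [hφ, h1]
        have h2 := (le_abs_self _).trans (hGb (r⁻¹ • (x - z)))
        have h3 : 0 ≤ r ^ (-(2 * s)) := by positivity
        exact mul_le_mul_of_nonneg_left (mul_le_mul_of_nonneg_left h2 h3) (by positivity)
      have hz0 : 0 < ‖z‖ := by linarith
      have e2 : r ^ (-(2 * s)) = 2 ^ (2 * s) * ‖z‖ ^ (-(2 * s)) := by
        rw [hr, Real.div_rpow hz0.le zero_le_two, Real.rpow_neg zero_le_two, div_inv_eq_mul,
          mul_comm]
      have e3 : 2 * u z * (4 * r⁻¹) = 16 * (u z * ‖z‖⁻¹) := by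
        rw [hr]; field_simp; norm_num
      rw [e3, Real.mul_rpow (by norm_num) (by positivity)] at key
      have e4 := mul_le_mul_of_nonneg_left e1 hCn0.le
      rw [e2, show Cn * (2 * u z * (2 ^ (2 * s) * ‖z‖ ^ (-(2 * s)) * G)) =
        Cn * 2 * 2 ^ (2 * s) * G * (u z * ‖z‖ ^ (-(2 * s))) by ring] at e4
      have h5 : 0 ≤ Cn * 2 * 2 ^ (2 * s) * G := by positivity
      have h6 : (0 : ℝ) < 16 ^ q := by positivity
      have h7 : 0 ≤ (u z * ‖z‖⁻¹) ^ q := by positivity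
      have h8 : 0 ≤ u z * ‖z‖ ^ (-(2 * s)) := by positivity
      rw [add_mul, mul_add, mul_add]
      linarith [mul_nonneg h5 h7, mul_nonneg h6.le h8]
    · simp only [hφ]
      rw [← mul_sub, abs_mul, abs_of_pos (by positivity : 0 < 2 * u z), mul_assoc (2 * u z)]
      refine mul_le_mul_of_nonneg_left ((abs_bump_sub_le _ _).trans (le_of_eq ?_)) (by positivity)
      rw [← smul_sub, sub_sub_sub_cancel_right, norm_smul, Real.norm_of_nonneg (by positivity)]
      ring

/-- If `u` does not blow up, its lower limit at infinity is zero: touching bumps around points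
where `u` stays bounded make `f(u)` arbitrarily small, so `u` itself, as `f` is nondecreasing. -/
lemma IsClassicalSupersolution.exists_lt (hN : 0 < N) (hs : 0 < s) (hs1 : s < 1)
    {q lam R₀ : ℝ} {f : ℝ → ℝ} {u : EuclideanSpace ℝ (Fin N) → ℝ}
    (hu : IsClassicalSupersolution s q lam R₀ f u) (hu0 : ∀ x, 0 < u x) (hR₀ : 0 < R₀)
    (hlam : 0 < lam) (hmono : MonotoneOn f (Ioi 0)) (hf : ∀ t, 0 < t → 0 < f t)
    (hq : 0 < q) (hblow : ¬ BlowsUpAtInfinity u) {δ : ℝ} (hδ : 0 < δ) (ρ : ℝ) :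
    ∃ x, ρ < ‖x‖ ∧ u x < δ := by
  by_contra! hcon
  obtain ⟨C, hC, hbump⟩ := hu.exists_touching_bump hN hs hs1 hu0 hR₀ hq.le
  obtain ⟨m, hm⟩ : ∃ m, ∃ᶠ x in Bornology.cobounded (EuclideanSpace ℝ (Fin N)), u x < m := by
    unfold BlowsUpAtInfinity at hblow
    rw [Filter.tendsto_atTop] at hblow
    push Not at hblow
    obtain ⟨m, hm⟩ := hblow
    exact ⟨m, hm.mono fun x hx => by simpa using hx⟩
  have hm0 : 0 < m := by
    obtain ⟨x, hx⟩ := hm.exists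
    exact (hu0 x).trans hx
  have hlim : Tendsto (fun r : ℝ => C * (m * r ^ (-(2 * s)) + (m * r⁻¹) ^ q)) atTop (𝓝 0) := by
    have h1 := (tendsto_rpow_neg_atTop (y := 2 * s) (by linarith)).const_mul m
    have h2 := ((tendsto_inv_atTop_zero (𝕜 := ℝ)).const_mul m).rpow_const (p := q) (Or.inr hq.le)
    have h3 := (h1.add h2).const_mul C
    simpa [Real.zero_rpow hq.ne'] using h3
  have hfδ : 0 < lam * f δ := mul_pos hlam (hf δ hδ)
  have hev := (tendsto_norm_cobounded_atTop (E := EuclideanSpace ℝ (Fin N))).eventually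
    ((hlim.eventually (gt_mem_nhds hfδ)).and
      ((eventually_gt_atTop (2 * ρ)).and (eventually_gt_atTop (2 * (R₀ + 1)))))
  obtain ⟨z, hzm, h1, h2, h3⟩ := (hm.and_eventually hev).exists
  obtain ⟨x, hxz, hxu, hx⟩ := hbump z h3
  have hxρ : ρ < ‖x‖ := by
    have := norm_sub_norm_le z x; rw [norm_sub_rev] at this; linarith
  have h4 := hmono hδ (hu0 x) (hcon x hxρ)
  have hz0 : 0 < ‖z‖ := by linarith
  have huz := hu0 z
  have h5 : C * (u z * ‖z‖ ^ (-(2 * s)) + (u z * ‖z‖⁻¹) ^ q) ≤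
      C * (m * ‖z‖ ^ (-(2 * s)) + (m * ‖z‖⁻¹) ^ q) := by gcongr
  have h6 : lam * f δ ≤ lam * f (u x) := by gcongr
  linarith

/-- There are points `x` arbitrarily far out with `u(x)` small and comparable to the minimum of
`u` over the ball of radius `|x| / 2` around `x`. Otherwise one could pass repeatedly to points
where `u` is smaller by a factor `2^{b+1}`, while `|x|` at most doubles; this contradicts `u ≥ c
|x|^{-b}`. -/
lemma exists_harnack_point {u : EuclideanSpace ℝ (Fin N) → ℝ} {R₀ R b c : ℝ}
    (hu0 : ∀ x, 0 < u x) (hu : ContinuousOn u {x | R₀ < ‖x‖}) (hR : R₀ < R) (hR0 : 0 < R)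
    (hc : 0 < c) (hlow : ∀ x, R < ‖x‖ → c * ‖x‖ ^ (-b) ≤ u x)
    (hsmall : ∀ δ > 0, ∀ ρ : ℝ, ∃ x, ρ < ‖x‖ ∧ u x < δ) (hb : 0 < b) {δ : ℝ} (hδ : 0 < δ) (ρ : ℝ) :
    ∃ x, ρ < ‖x‖ ∧ u x < δ ∧ ∀ y, ‖y - x‖ < ‖x‖ / 2 → u x ≤ 2 ^ (b + 1) * u y := by
  by_contra! hcon
  set ρ' := max ρ (2 * R) with hρ'
  have hρR : 2 * R ≤ ρ' := le_max_right _ _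
  obtain ⟨δ₁, hδ₁, hδ₁u⟩ := exists_pos_le_of_annulus hu0 hu hR ρ'
  set δ' := min δ δ₁ with hδ'
  have hδ'0 : 0 < δ' := lt_min hδ hδ₁
  obtain ⟨x₀, hx₀ρ, hx₀u⟩ := hsmall δ' hδ'0 ρ'
  have hx₀ : 0 < ‖x₀‖ := by linarith
  have step : ∀ k : ℕ, ∃ x, ρ' < ‖x‖ ∧ ‖x‖ ≤ 2 ^ k * ‖x₀‖ ∧ u x < δ' ∧
      (2 ^ (b + 1)) ^ k * u x ≤ u x₀ := by
    intro k
    induction k with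
    | zero => exact ⟨x₀, hx₀ρ, by simp, hx₀u, by simp⟩
    | succ k ih =>
      obtain ⟨x, h1, h2, h3, h4⟩ := ih
      obtain ⟨y, hy, hyu⟩ := hcon x ((le_max_left _ _).trans_lt h1) (h3.trans_le (min_le_left _ _))
      have hyl : ‖x‖ / 2 ≤ ‖y‖ := by
        have := norm_sub_norm_le x y; rw [norm_sub_rev] at this; linarith
      have hyup : ‖y‖ ≤ 2 * ‖x‖ := by
        have := norm_sub_norm_le y x; linarith
      have h2b : (1 : ℝ) ≤ 2 ^ (b + 1) := Real.one_le_rpow one_le_two (by linarith)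
      have hyδ : u y < δ' := by nlinarith [hu0 y]
      refine ⟨y, ?_, ?_, hyδ, ?_⟩
      · by_contra h
        have := hδ₁u y (by linarith) (not_lt.1 h)
        linarith [min_le_right δ δ₁]
      · rw [pow_succ]; linarith
      · rw [pow_succ, mul_assoc]
        refine le_trans ?_ h4
        gcongr
  have hlim : Tendsto (fun k : ℕ => (1 / 2 : ℝ) ^ k * u x₀) atTop (𝓝 0) := by
    simpa using (tendsto_pow_atTop_nhds_zero_of_lt_one (by norm_num : (0 : ℝ) ≤ 1 / 2)
      (by norm_num)).mul_const (u x₀)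
  obtain ⟨k, hk⟩ := (hlim.eventually (gt_mem_nhds (show 0 < c * ‖x₀‖ ^ (-b) by positivity))).exists
  obtain ⟨x, h1, h2, -, h4⟩ := step k
  have hx : 0 < ‖x‖ := by linarith
  have h5 : c * (2 ^ k * ‖x₀‖) ^ (-b) ≤ u x := by
    refine le_trans ?_ (hlow x (by linarith))
    gcongr ?_ * ?_
    exact Real.rpow_le_rpow_of_nonpos hx h2 (by linarith)
  have e1 : ((2 : ℝ) ^ k * ‖x₀‖) ^ (-b) = (2 ^ (-b)) ^ k * ‖x₀‖ ^ (-b) := by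
    rw [Real.mul_rpow (by positivity) hx₀.le, ← Real.rpow_natCast, ← Real.rpow_natCast,
      ← Real.rpow_mul zero_le_two, ← Real.rpow_mul zero_le_two, mul_comm (k : ℝ)]
  have e2 : ((2 : ℝ) ^ (b + 1)) ^ k * (2 ^ (-b)) ^ k = 2 ^ k := by
    rw [← mul_pow, ← Real.rpow_add zero_lt_two]; congr 1; norm_num
  rw [e1] at h5
  have h6 : 2 ^ k * (c * ‖x₀‖ ^ (-b)) ≤ u x₀ := by
    refine le_trans ?_ h4
    rw [← e2]
    calc _ = (2 ^ (b + 1)) ^ k * (c * ((2 ^ (-b)) ^ k * ‖x₀‖ ^ (-b))) := by ring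
      _ ≤ _ := by gcongr
  have h7 : c * ‖x₀‖ ^ (-b) ≤ (1 / 2) ^ k * u x₀ := by
    rw [one_div, inv_pow, inv_mul_eq_div, le_div_iff₀ (by positivity)]; linarith
  linarith

/-- The numerical contradiction: for `m ≥ c r^{-b} log r` and `r` large, `m^p` exceeds any
multiple of `m r^{-2s} + (m / r)^q`. The logarithm takes care of the first term, which is
critical, and `q (b + 1) > N = b p` of the second. -/
lemma exists_forall_add_rpow_lt {b s p q A c : ℝ} (hb : 0 < b) (hs : 0 < s)
    (hp : p = (b + 2 * s) / b) (hq0 : 0 < q) (hq : b + 2 * s < q * (b + 1)) (hA : 0 < A)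
    (hc : 0 < c) :
    ∃ ρ > 0, ∀ r m : ℝ, ρ < r → 0 < m → m ≤ 1 → c * r ^ (-b) * Real.log r ≤ m →
      m * r ^ (-(2 * s)) + (m * r⁻¹) ^ q < A * m ^ p := by
  have hp1 : p - 1 = 2 * s / b := by rw [hp]; field_simp; ring
  have hp0 : 0 < p - 1 := by rw [hp1]; positivity
  have hbp : b * (p - 1) = 2 * s := by rw [hp1]; field_simp
  have l1 : Tendsto (fun r : ℝ => c * Real.log r) atTop atTop :=
    Real.tendsto_log_atTop.const_mul_atTop hc
  have l2 : Tendsto (fun r : ℝ => (c * Real.log r) ^ (p - 1)) atTop atTop :=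
    (tendsto_rpow_atTop hp0).comp l1
  have l3 := tendsto_rpow_neg_atTop hq0
  have l4 := tendsto_rpow_neg_atTop (y := q * (b + 1) - (b + 2 * s)) (by linarith)
  have hA2 : 0 < A / 2 := by positivity
  obtain ⟨ρ, hρ⟩ := eventually_atTop.1 ((l1.eventually (eventually_ge_atTop 1)).and
    ((l2.eventually (eventually_gt_atTop (2 / A))).and
    ((l3.eventually (gt_mem_nhds hA2)).and (l4.eventually (gt_mem_nhds hA2)))))
  refine ⟨max ρ 1, by positivity, fun r m hr hm hm1 hlow => ?_⟩
  obtain ⟨h1, h2, h3, h4⟩ := hρ r ((le_max_left _ _).trans hr.le)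
  have hr0 : 0 < r := by linarith [le_max_right ρ 1]
  have hlow' : (c * Real.log r) * r ^ (-b) ≤ m := by linarith
  have hrb : r ^ (-b) ≤ m := by
    have : 0 < r ^ (-b) := by positivity
    nlinarith
  have hmp : m ^ p = m * m ^ (p - 1) := by
    rw [← Real.rpow_one_add' hm.le (by linarith)]; congr 1; ring
  have first : m * r ^ (-(2 * s)) < A / 2 * m ^ p := by
    have h5 : (c * Real.log r) ^ (p - 1) * r ^ (-(2 * s)) ≤ m ^ (p - 1) := by
      have e : r ^ (-(2 * s)) = (r ^ (-b)) ^ (p - 1) := by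
        rw [← Real.rpow_mul hr0.le, neg_mul, hbp]
      rw [e, ← Real.mul_rpow (by linarith) (by positivity)]
      exact Real.rpow_le_rpow (mul_nonneg (by linarith) (by positivity)) hlow' hp0.le
    have h6 : 2 / A * r ^ (-(2 * s)) < m ^ (p - 1) := by
      refine lt_of_lt_of_le ?_ h5
      gcongr
    rw [hmp]
    calc m * r ^ (-(2 * s)) = A / 2 * (m * (2 / A * r ^ (-(2 * s)))) := by field_simp
      _ < _ := by gcongr
  have second : (m * r⁻¹) ^ q < A / 2 * m ^ p := by
    have e : (m * r⁻¹) ^ q = m ^ (q - p) * r ^ (-q) * m ^ p := by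
      rw [Real.mul_rpow hm.le (by positivity), Real.inv_rpow hr0.le, Real.rpow_neg hr0.le,
        Real.rpow_sub hm]
      field_simp
    rw [e]
    gcongr
    rcases le_or_gt p q with hpq | hpq
    · have : m ^ (q - p) ≤ 1 := Real.rpow_le_one hm.le hm1 (by linarith)
      have : 0 < r ^ (-q) := by positivity
      nlinarith
    · have h7 : m ^ (q - p) ≤ (r ^ (-b)) ^ (q - p) :=
        Real.rpow_le_rpow_of_nonpos (by positivity) hrb (by linarith)
      refine lt_of_le_of_lt ?_ h4
      calc _ ≤ (r ^ (-b)) ^ (q - p) * r ^ (-q) := by gcongr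
        _ = _ := by
          rw [← Real.rpow_mul hr0.le, ← Real.rpow_add hr0]
          congr 1
          have : b * p = b + 2 * s := by rw [hp]; field_simp
          linarith
  linarith

end

theorem theorem2 (N : ℕ) (s p q lam R₀ : ℝ) (f : ℝ → ℝ)
    (hs : 1 < 2 * s) (hs1 : s < 1) (hN : 2 * s < (N : ℝ))
    (hlam : 0 < lam) (hR₀ : 0 < R₀)
    (hf_cont : ContinuousOn f (Set.Ioi 0))
    (hf_pos : ∀ t, 0 < t → 0 < f t)
    (hf_mono : MonotoneOn f (Set.Ioi 0))
    (hp : p = (N : ℝ) / ((N : ℝ) - 2 * s))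
    (hf_liminf : 0 < liminf (fun t : ℝ => ((f t / t ^ p : ℝ) : EReal)) (𝓝[>] (0 : ℝ)))
    (hq : (N : ℝ) / ((N : ℝ) + 1 - 2 * s) < q) :
    ¬ ∃ u : EuclideanSpace ℝ (Fin N) → ℝ,
      (∀ x, 0 < u x) ∧ IsClassicalSupersolution s q lam R₀ f u ∧ ¬ BlowsUpAtInfinity u := by
  rintro ⟨u, hu0, hu, hblow⟩
  have hs0 : 0 < s := by linarith
  have hN0 : 0 < N := by
    have : (0 : ℝ) < N := by linarith
    exact_mod_cast this
  have hb : 0 < (N : ℝ) - 2 * s := by linarith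
  have hq' : (N : ℝ) < q * ((N : ℝ) - 2 * s + 1) := by
    rw [div_lt_iff₀ (by linarith)] at hq; linarith
  have hq1 : 1 ≤ q := by
    refine le_trans ?_ hq.le
    rw [one_le_div (by linarith)]; linarith
  obtain ⟨c₀, hc₀, t₀, ht₀, hf⟩ := exists_rpow_le_of_liminf hf_liminf
  obtain ⟨c₁, hc₁, hlow⟩ := hu.exists_rpow_le hN0 hs0 hs1 hN hu0 hR₀ hlam hf_pos hq1 hq'
  obtain ⟨c₂, hc₂, hlog⟩ := hu.exists_log_le hN0 hs0 hs1 hN hu0 hR₀ hlam hf_mono hp hc₀ ht₀ hf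
    hq1 hq'
  obtain ⟨C, hC, hbump⟩ := hu.exists_touching_bump hN0 hs0 hs1 hu0 hR₀ (q := q) (by linarith)
  set K : ℝ := 2 ^ ((N : ℝ) - 2 * s + 1) with hK
  have hK0 : 0 < K := by positivity
  obtain ⟨ρ, hρ, hlt⟩ := exists_forall_add_rpow_lt (p := p) (A := lam * (c₀ * (K⁻¹) ^ p) / C) hb hs0
    (by rw [hp]; congr 1; ring) (by linarith : 0 < q) (by linarith) (by positivity) hc₂
  obtain ⟨z, hzρ, hzδ, hz⟩ := exists_harnack_point (δ := min 1 t₀) hu0 hu.contDiffOn.continuousOn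
    (by linarith : R₀ < R₀ + 1) (by linarith) hc₁ hlow
    (fun δ hδ ρ => hu.exists_lt hN0 hs0 hs1 hu0 hR₀ hlam hf_mono hf_pos (by linarith) hblow hδ ρ)
    hb (lt_min one_pos ht₀) (max ρ (2 * (R₀ + 1)))
  obtain ⟨hz1, hz2⟩ := max_lt_iff.1 hzρ
  obtain ⟨hd1, hd2⟩ := lt_min_iff.1 hzδ
  obtain ⟨x, hxz, hxu, hx⟩ := hbump z hz2
  have huz := hu0 z
  have h1 : K⁻¹ * u z ≤ u x := by
    rw [inv_mul_eq_div, div_le_iff₀ hK0]; linarith [hz x hxz]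
  have hp0 : 0 < p := by rw [hp]; exact div_pos (by linarith) hb
  have h2 : c₀ * (K⁻¹ * u z) ^ p ≤ f (u x) :=
    le_trans (by gcongr) (hf (u x) (hu0 x) (by linarith))
  have h3 := hlt ‖z‖ (u z) hz1 huz hd1.le (hlog z (by linarith))
  have h4 : lam * (c₀ * (K⁻¹ * u z) ^ p) ≤
      C * (u z * ‖z‖ ^ (-(2 * s)) + (u z * ‖z‖⁻¹) ^ q) :=
    le_trans (by gcongr) hx
  rw [Real.mul_rpow (by positivity) huz.le] at h4
  have h5 : C * (u z * ‖z‖ ^ (-(2 * s)) + (u z * ‖z‖⁻¹) ^ q) <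
      C * (lam * (c₀ * (K⁻¹) ^ p) / C * u z ^ p) := by gcongr
  have h6 : C * (lam * (c₀ * (K⁻¹) ^ p) / C * u z ^ p) = lam * (c₀ * (K⁻¹ ^ p * u z ^ p)) := by
    field_simp
  linarith
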